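/- Let $\mathcal{C}$ be the Cesàro operator on $L^2(\mathbb{R})$, $(\mathcal{C}f)(x)=\frac1x\int_0^x f(t)\,dt=\int_0^1 f(ux)\,du$, and for $\mathrm{Re}\,\alpha>0$ let $H_\alpha$ be the bounded Hölder operator on $L^2(\mathbb{R})$, $$(H_\alpha f)(x)=\frac{1}{\Gamma(\alpha)}\int_0^1\Bigl(\log\frac1u\Bigr)^{\alpha-1}f(ux)\,du,$$ and put $H_0:=I$. Then $\mathcal{C}$ is a normal operator, and $H_\alpha=\mathcal{C}^\alpha$ for $\mathrm{Re}\,\alpha>0$, where $\mathcal{C}^\alpha$ is given by the functional calculus of the normal operator $\mathcal{C}$ applied to $z\mapsto z^\alpha$ (principal branch, $1^\alpha=1$, $0^\alpha:=0$). Moreover: (i) The family $(H_\alpha)$ is a semigroup, holomorphic in the right half-plane: $H_{\alpha+\beta}=H_\alpha H_\beta$ for all $\alpha,\beta\in\{0\}\cup\{\mathrm{Re}\,z>0\}$; the map $\alpha\mapsto H_\alpha$ is holomorphic (in operator norm) in $\{\mathrm{Re}\,\alpha>0\}$; and for every $\delta<\pi/2$ and $f\in L^2(\mathbb{R})$, $H_\alpha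 f\to f$ as $\alpha\to0$, $\alpha\neq 0$, $|\arg\alpha|\le\delta$. (ii) The generator $A$ of this semigroup, $Af=\lim_{t\to0+}t^{-1}(H_tf-f)$ on the domain of all $f\in L^2(\mathbb{R})$ for which the limit exists, is a (possibly unbounded) normal operator, i.e. $A$ is closed, densely defined, and $AA^*=A^*A$; and there is $\gamma<\infty$ such that its spectrum lies in the half-plane $\{z:\mathrm{Re}\,z\le\gamma\}$. (iii) The restriction $(H_t)_{t\ge0}$ is a positive strongly continuous semigroup: if $f\ge0$ a.e., then $H_tf\ge0$ a.e. for every $t\ge0$. -/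

import Mathlib

open MeasureTheory Filter Topology
open scoped ENNReal

/-- The complex Hilbert space `L²(ℝ)` with respect to Lebesgue measure. -/
abbrev L2R : Type := Lp ℂ 2 (volume : Measure ℝ)

/-- `K(u) |u|^{-1/2} ∈ L¹(ℝ)`: the condition under which `K` defines a Hausdorff operator. -/
def HausdorffKernel (K : ℝ → ℂ) : Prop :=
  Integrable (fun u : ℝ => K u * ((|u| ^ (-(1 / 2) : ℝ) : ℝ) : ℂ))

/-- The function `x ↦ ∫ K(u) f(u x) du`. -/
noncomputable def hausdorffFun (K : ℝ → ℂ) (f : ℝ → ℂ) (x : ℝ) : ℂ := ∫ u : ℝ, K u * f (u * x)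

theorem ae_ne_zero_real : ∀ᵐ u : ℝ, u ≠ 0 := by
  simp [ae_iff]

theorem HausdorffKernel.aestronglyMeasurable {K : ℝ → ℂ} (hK : HausdorffKernel K) :
    AEStronglyMeasurable K volume := by
  have h1 : AEStronglyMeasurable (fun u : ℝ => ((|u| ^ ((1 / 2) : ℝ) : ℝ) : ℂ)) volume := by
    apply Measurable.aestronglyMeasurable
    fun_prop
  refine (hK.1.mul h1).congr ?_
  filter_upwards [ae_ne_zero_real] with u hu
  have h2 : |u| ^ (-(1 / 2) : ℝ) * |u| ^ ((1 / 2) : ℝ) = 1 := by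
    rw [← Real.rpow_add (abs_pos.2 hu)]; norm_num
  simp only [Pi.mul_apply]
  rw [mul_assoc, ← Complex.ofReal_mul, h2]; simp

theorem quasiMeasurePreserving_mul_pair :
    Measure.QuasiMeasurePreserving (fun p : ℝ × ℝ => p.2 * p.1)
      ((volume : Measure ℝ).prod volume) volume := by
  refine ⟨by fun_prop, ?_⟩
  refine Measure.AbsolutelyContinuous.mk fun s hs h0 => ?_
  rw [Measure.map_apply (by fun_prop) hs, Measure.measure_prod_null (by measurability)]
  filter_upwards [ae_ne_zero_real] with x hx
  have : (Prod.mk x ⁻¹' ((fun p : ℝ × ℝ => p.2 * p.1) ⁻¹' s)) = (fun u => u * x) ⁻¹' s := rfl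
  rw [this, Real.volume_preimage_mul_right hx, h0]; simp

theorem hausdorff_bound {K : ℝ → ℂ} (hK : HausdorffKernel K) {g : ℝ → ℂ}
    (hg : StronglyMeasurable g) :
    ∫⁻ x, (∫⁻ u, ‖K u * g (u * x)‖ₑ) ^ (2 : ℝ) ≤
      (∫⁻ u, ‖K u * ((|u| ^ (-(1 / 2) : ℝ) : ℝ) : ℂ)‖ₑ) ^ (2 : ℝ) * ∫⁻ x, ‖g x‖ₑ ^ (2 : ℝ) := by
  set k : ℝ → ℝ≥0∞ := fun u => ‖K u * ((|u| ^ (-(1 / 2) : ℝ) : ℝ) : ℂ)‖ₑ with hk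
  have hkm : AEMeasurable k := hK.1.enorm
  have hgm : Measurable g := hg.measurable
  have step : ∀ x : ℝ, (∫⁻ u, ‖K u * g (u * x)‖ₑ) ^ (2 : ℝ) ≤
      (∫⁻ u, k u) * ∫⁻ u, k u * (ENNReal.ofReal |u| * ‖g (u * x)‖ₑ ^ (2 : ℝ)) := by
    intro x
    have e1 : ∫⁻ u, ‖K u * g (u * x)‖ₑ = ∫⁻ u, ((fun u => (k u) ^ (1 / 2 : ℝ)) *
        (fun u => (k u * (ENNReal.ofReal |u| * ‖g (u * x)‖ₑ ^ (2 : ℝ))) ^ (1 / 2 : ℝ))) u := by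
      apply lintegral_congr_ae
      filter_upwards [ae_ne_zero_real] with u hu
      have h2 : |u| ^ (-(1 / 2) : ℝ) * |u| ^ ((1 / 2) : ℝ) = 1 := by
        rw [← Real.rpow_add (abs_pos.2 hu)]; norm_num
      have h0 : (0 : ℝ) ≤ |u| ^ (-(1 / 2) : ℝ) := by positivity
      simp only [Pi.mul_apply]
      rw [ENNReal.mul_rpow_of_nonneg _ _ (by norm_num : (0 : ℝ) ≤ 1 / 2), ← mul_assoc,
        ← ENNReal.rpow_add_of_nonneg _ _ (by norm_num) (by norm_num),
        ENNReal.mul_rpow_of_nonneg _ _ (by norm_num : (0 : ℝ) ≤ 1 / 2), ← ENNReal.rpow_mul,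
        ENNReal.ofReal_rpow_of_nonneg (abs_nonneg u) (by norm_num)]
      norm_num
      simp only [hk, enorm_mul]
      rw [mul_assoc, ← mul_assoc (‖((|u| ^ (-(1 / 2) : ℝ) : ℝ) : ℂ)‖ₑ)]
      have : ‖((|u| ^ (-(1 / 2) : ℝ) : ℝ) : ℂ)‖ₑ * ENNReal.ofReal (|u| ^ (1 / 2 : ℝ)) = 1 := by
        rw [← ofReal_norm, Complex.norm_real, Real.norm_of_nonneg h0,
          ← ENNReal.ofReal_mul h0, h2, ENNReal.ofReal_one]
      rw [this, one_mul]
    have e2 := ENNReal.lintegral_mul_le_Lp_mul_Lq (volume : Measure ℝ)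
      (p := 2) (q := 2) (by rw [Real.holderConjugate_iff]; norm_num)
      (f := fun u => (k u) ^ (1 / 2 : ℝ))
      (g := fun u => (k u * (ENNReal.ofReal |u| * ‖g (u * x)‖ₑ ^ (2 : ℝ))) ^ (1 / 2 : ℝ))
      (hkm.pow_const _) ((hkm.mul (by fun_prop)).pow_const _)
    rw [← e1] at e2
    refine (ENNReal.rpow_le_rpow e2 (by norm_num : (0 : ℝ) ≤ 2)).trans (le_of_eq ?_)
    rw [ENNReal.mul_rpow_of_nonneg _ _ (by norm_num : (0 : ℝ) ≤ 2)]
    simp only [← ENNReal.rpow_mul]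
    norm_num
  have hm2 : AEMeasurable (Function.uncurry fun x u : ℝ =>
      k u * (ENNReal.ofReal |u| * ‖g (u * x)‖ₑ ^ (2 : ℝ)))
      ((volume : Measure ℝ).prod volume) := by
    refine AEMeasurable.mul ?_ ?_
    · exact hkm.comp_quasiMeasurePreserving Measure.quasiMeasurePreserving_snd
    · apply Measurable.aemeasurable
      fun_prop
  calc ∫⁻ x, (∫⁻ u, ‖K u * g (u * x)‖ₑ) ^ (2 : ℝ)
      ≤ ∫⁻ x, (∫⁻ u, k u) * ∫⁻ u, k u * (ENNReal.ofReal |u| * ‖g (u * x)‖ₑ ^ (2 : ℝ)) :=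
        lintegral_mono step
    _ = (∫⁻ u, k u) * ∫⁻ x, ∫⁻ u, k u * (ENNReal.ofReal |u| * ‖g (u * x)‖ₑ ^ (2 : ℝ)) :=
        lintegral_const_mul' _ _ hK.2.ne
    _ = (∫⁻ u, k u) * ∫⁻ u, ∫⁻ x, k u * (ENNReal.ofReal |u| * ‖g (u * x)‖ₑ ^ (2 : ℝ)) := by
        rw [lintegral_lintegral_swap hm2]
    _ = (∫⁻ u, k u) * ∫⁻ u, k u * ∫⁻ x, ‖g x‖ₑ ^ (2 : ℝ) := by
        congr 1
        apply lintegral_congr_ae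
        filter_upwards [ae_ne_zero_real] with u hu
        rw [lintegral_const_mul _ (by fun_prop), lintegral_const_mul _ (by fun_prop)]
        congr 1
        have hmap := Real.map_volume_mul_left hu
        have : ∫⁻ x, ‖g (u * x)‖ₑ ^ (2 : ℝ) = ∫⁻ y, ‖g y‖ₑ ^ (2 : ℝ) ∂(Measure.map (u * ·) volume) := by
          rw [lintegral_map (by fun_prop) (by fun_prop)]
        rw [this, hmap, lintegral_smul_measure, smul_eq_mul, ← mul_assoc,
          ← ENNReal.ofReal_mul (abs_nonneg u), abs_inv, mul_inv_cancel₀ (abs_ne_zero.2 hu)]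
        simp
    _ = _ := by
        rw [lintegral_mul_const'' _ hkm, ← mul_assoc]
        congr 1
        rw [show (2 : ℝ) = 1 + 1 by norm_num, ENNReal.rpow_add_of_nonneg _ _ (by norm_num) (by norm_num)]
        simp

theorem hausdorffFun_congr (K : ℝ → ℂ) {f g : ℝ → ℂ} (h : f =ᵐ[volume] g) :
    hausdorffFun K f =ᵐ[volume] hausdorffFun K g := by
  filter_upwards [ae_ne_zero_real] with x hx
  have hq : Measure.QuasiMeasurePreserving (fun u : ℝ => u * x) volume volume := by
    refine ⟨by fun_prop, ?_⟩
    rw [Real.map_volume_mul_right hx]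
    exact Measure.smul_absolutelyContinuous
  apply integral_congr_ae
  filter_upwards [hq.ae h] with u hu
  rw [hu]

theorem hausdorff_integrable {K : ℝ → ℂ} (hK : HausdorffKernel K) (f : L2R) :
    ∀ᵐ x : ℝ, Integrable (fun u : ℝ => K u * f (u * x)) := by
  have hf := Lp.stronglyMeasurable f
  have hb := hausdorff_bound hK hf
  have h2 : ∫⁻ x, ‖f x‖ₑ ^ (2 : ℝ) < ∞ := by
    have := lintegral_rpow_enorm_lt_top_of_eLpNorm_lt_top (p := 2) (by norm_num) (by norm_num)
      (Lp.memLp f).2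
    simpa using this
  have h3 : AEStronglyMeasurable (fun p : ℝ × ℝ => K p.2 * f (p.2 * p.1))
      ((volume : Measure ℝ).prod volume) :=
    (hK.aestronglyMeasurable.comp_quasiMeasurePreserving
      Measure.quasiMeasurePreserving_snd).mul
      (hf.comp_measurable (by fun_prop)).aestronglyMeasurable
  have h4 : AEMeasurable (fun x => (∫⁻ u, ‖K u * f (u * x)‖ₑ) ^ (2 : ℝ)) :=
    (h3.enorm.lintegral_prod_right').pow_const _
  have h5 := ae_lt_top' h4 (hb.trans_lt (ENNReal.mul_lt_top
    (ENNReal.rpow_lt_top_of_nonneg (by norm_num) hK.2.ne) h2)).ne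
  filter_upwards [h5, ae_ne_zero_real] with x hx hx0
  refine ⟨hK.aestronglyMeasurable.mul (hf.comp_measurable (by fun_prop)).aestronglyMeasurable, ?_⟩
  exact (ENNReal.rpow_lt_top_iff_of_pos (by norm_num : (0 : ℝ) < 2)).1 hx

theorem eLpNorm_hausdorffFun_le {K : ℝ → ℂ} (hK : HausdorffKernel K) (f : L2R) :
    eLpNorm (hausdorffFun K f) 2 volume ≤
      (∫⁻ u, ‖K u * ((|u| ^ (-(1 / 2) : ℝ) : ℝ) : ℂ)‖ₑ) * eLpNorm f 2 volume := by
  have hf := Lp.stronglyMeasurable f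
  have hb := hausdorff_bound hK hf
  rw [eLpNorm_eq_lintegral_rpow_enorm_toReal (by norm_num) (by norm_num),
    eLpNorm_eq_lintegral_rpow_enorm_toReal (by norm_num) (by norm_num)]
  simp only [ENNReal.toReal_ofNat]
  have h1 : ∫⁻ x, ‖hausdorffFun K f x‖ₑ ^ (2 : ℝ) ≤
      ∫⁻ x, (∫⁻ u, ‖K u * f (u * x)‖ₑ) ^ (2 : ℝ) :=
    lintegral_mono fun x =>
      ENNReal.rpow_le_rpow (enorm_integral_le_lintegral_enorm _) (by norm_num)
  refine (ENNReal.rpow_le_rpow (h1.trans hb) (by norm_num : (0 : ℝ) ≤ 1 / 2)).trans (le_of_eq ?_)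
  rw [ENNReal.mul_rpow_of_nonneg _ _ (by norm_num : (0 : ℝ) ≤ 1 / 2), ← ENNReal.rpow_mul]
  norm_num

theorem hausdorffFun_memLp {K : ℝ → ℂ} (hK : HausdorffKernel K) (f : L2R) :
    MemLp (hausdorffFun K f) 2 volume := by
  refine ⟨?_, (eLpNorm_hausdorffFun_le hK f).trans_lt
    (ENNReal.mul_lt_top hK.2 (Lp.memLp f).2)⟩
  have h3 : AEStronglyMeasurable (fun p : ℝ × ℝ => K p.2 * f (p.2 * p.1))
      ((volume : Measure ℝ).prod volume) :=
    (hK.aestronglyMeasurable.comp_quasiMeasurePreserving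
      Measure.quasiMeasurePreserving_snd).mul
      ((Lp.stronglyMeasurable f).comp_measurable (by fun_prop)).aestronglyMeasurable
  exact h3.integral_prod_right'

/-- The Hausdorff operator `(H_K f)(x) = ∫ K(u) f(u x) du` as a bounded operator on `L²(ℝ)`. -/
noncomputable def hausdorffOp (K : ℝ → ℂ) (hK : HausdorffKernel K) : L2R →L[ℂ] L2R :=
  LinearMap.mkContinuous
    { toFun := fun f => (hausdorffFun_memLp hK f).toLp _
      map_add' := fun f g => by
        rw [← MemLp.toLp_add]
        apply MemLp.toLp_congr
        filter_upwards [hausdorffFun_congr K (Lp.coeFn_add f g), hausdorff_integrable hK f,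
          hausdorff_integrable hK g] with x h1 h2 h3
        rw [h1]
        simp only [hausdorffFun, Pi.add_apply, mul_add]
        exact integral_add h2 h3
      map_smul' := fun c f => by
        rw [RingHom.id_apply, ← MemLp.toLp_const_smul]
        apply MemLp.toLp_congr
        filter_upwards [hausdorffFun_congr K (Lp.coeFn_smul c f)] with x h1
        rw [h1]
        simp only [hausdorffFun, Pi.smul_apply, smul_eq_mul, mul_left_comm _ c]
        exact integral_const_mul _ _ }
    (∫⁻ u, ‖K u * ((|u| ^ (-(1 / 2) : ℝ) : ℝ) : ℂ)‖ₑ).toReal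
    fun f => by
      change ‖(hausdorffFun_memLp hK f).toLp _‖ ≤ _
      rw [Lp.norm_toLp, Lp.norm_def, ← ENNReal.toReal_mul]
      exact ENNReal.toReal_mono (ENNReal.mul_lt_top hK.2 (Lp.memLp f).2).ne
        (eLpNorm_hausdorffFun_le hK f)

theorem hausdorffOp_apply_ae (K : ℝ → ℂ) (hK : HausdorffKernel K) (f : L2R) :
    hausdorffOp K hK f =ᵐ[volume] fun x => ∫ u : ℝ, K u * f (u * x) :=
  MemLp.coeFn_toLp (hausdorffFun_memLp hK f)

/-- The kernel `Γ(α)⁻¹ (log (1/u))^{α-1} χ_{(0,1)}(u)` of the Hölder means of order `α`. -/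
noncomputable def holderKernel (α : ℂ) : ℝ → ℂ :=
  (Set.Ioo (0 : ℝ) 1).indicator
    fun u => (1 / Complex.Gamma α) * ((Real.log (1 / u) : ℝ) : ℂ) ^ (α - 1)

theorem hausdorffKernel_holderKernel {α : ℂ} (hα : 0 < α.re) :
    HausdorffKernel (holderKernel α) := by
  have h1 : IntegrableOn (fun t : ℝ => (Real.exp (-(t / 2)) : ℂ) * (t : ℂ) ^ (α - 1))
      (Set.Ioi 0) := by
    have h := (Complex.GammaIntegral_convergent hα)
    have h2 := (integrableOn_Ioi_comp_mul_left_iff (fun x : ℝ =>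
      ((Real.exp (-x) : ℝ) : ℂ) * (x : ℂ) ^ (α - 1)) 0 (by norm_num : (0 : ℝ) < 1 / 2)).2
      (by simpa using h)
    have h3 := h2.const_mul (((2 : ℝ) : ℂ) ^ (α - 1))
    refine IntegrableOn.congr_fun h3 (fun t ht => ?_) measurableSet_Ioi
    have ht' : (0 : ℝ) < t := ht
    rw [Complex.ofReal_mul, Complex.mul_cpow_ofReal_nonneg (by norm_num) ht'.le]
    have : ((2 : ℝ) : ℂ) ^ (α - 1) * (((1 / 2 : ℝ) : ℝ) : ℂ) ^ (α - 1) = 1 := by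
      rw [← Complex.mul_cpow_ofReal_nonneg (by norm_num) (by norm_num), ← Complex.ofReal_mul]
      norm_num
    rw [show -(t / 2) = -(1 / 2 * t) by ring]
    linear_combination (((Real.exp (-(1 / 2 * t)) : ℝ) : ℂ) * (t : ℂ) ^ (α - 1)) * this
  have himg : (fun t : ℝ => Real.exp (-t)) '' (Set.Ioi 0) = Set.Ioo 0 1 := by
    ext u
    constructor
    · rintro ⟨t, ht, rfl⟩
      exact ⟨Real.exp_pos _, by simpa using ht⟩
    · rintro ⟨h0, h1⟩
      exact ⟨-Real.log u, by simpa using Real.log_neg h0 h1, by simp [Real.exp_log h0]⟩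
  have h2 : IntegrableOn (fun u : ℝ => ((Real.log (1 / u) : ℝ) : ℂ) ^ (α - 1) *
      ((|u| ^ (-(1 / 2) : ℝ) : ℝ) : ℂ)) (Set.Ioo 0 1) := by
    rw [← himg, integrableOn_image_iff_integrableOn_abs_deriv_smul (f := fun t => Real.exp (-t))
      (f' := fun t => -Real.exp (-t)) measurableSet_Ioi
      (fun t _ => by simpa using ((hasDerivAt_neg t).exp).hasDerivWithinAt)
      (fun a _ b _ h => by simpa using h)]
    refine IntegrableOn.congr_fun h1 (fun t ht => ?_) measurableSet_Ioi
    simp only [one_div, Real.log_inv, Real.log_exp, neg_neg, abs_neg, Real.abs_exp,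
      Complex.real_smul]
    rw [← Real.exp_mul, mul_comm ((t : ℂ) ^ _), ← mul_assoc, ← Complex.ofReal_mul, ← Real.exp_add]
    congr 3
    ring
  have h3 := (integrable_indicator_iff measurableSet_Ioo).2
    (Integrable.const_mul h2 (1 / Complex.Gamma α))
  refine h3.congr (Eventually.of_forall fun u => ?_)
  by_cases hu : u ∈ Set.Ioo (0 : ℝ) 1
  · simp [holderKernel, hu, mul_assoc]
  · simp [holderKernel, hu]

/-- The Hölder operators: for `Re α > 0`,
`(H_α f)(x) = Γ(α)⁻¹ ∫_0^1 (log (1/u))^{α-1} f(u x) du`, and `H_0 = I`.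
(The value `I` at the remaining `α ≠ 0` with `Re α ≤ 0` is a placeholder that is never used.) -/
noncomputable def holderOp (α : ℂ) : L2R →L[ℂ] L2R :=
  if h : 0 < α.re then hausdorffOp (holderKernel α) (hausdorffKernel_holderKernel h) else 1

theorem holderOp_apply_ae {α : ℂ} (hα : 0 < α.re) (f : L2R) :
    holderOp α f =ᵐ[volume] fun x =>
      (1 / Complex.Gamma α) *
        ∫ u in Set.Ioo (0 : ℝ) 1, ((Real.log (1 / u) : ℝ) : ℂ) ^ (α - 1) * f (u * x) := by
  rw [holderOp, dif_pos hα]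
  refine (hausdorffOp_apply_ae _ _ f).trans (Eventually.of_forall fun x => ?_)
  simp only [holderKernel]
  rw [← integral_const_mul, ← integral_indicator measurableSet_Ioo]
  congr 1
  ext u
  by_cases hu : u ∈ Set.Ioo (0 : ℝ) 1
  · simp [hu, mul_assoc]
  · simp [hu]

/-- The kernel `χ_{(0,1)}` of the Cesàro operator. -/
noncomputable def cesaroKernel : ℝ → ℂ := (Set.Ioo (0 : ℝ) 1).indicator fun _ => 1

theorem hausdorffKernel_cesaroKernel : HausdorffKernel cesaroKernel := by
  have h := hausdorffKernel_holderKernel (α := 1) (by simp)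
  have h2 : holderKernel 1 = cesaroKernel := by
    ext u
    simp [holderKernel, cesaroKernel]
  rwa [h2] at h

/-- The Cesàro operator `(C f)(x) = (1/x) ∫_0^x f(t) dt = ∫_0^1 f(u x) du` on `L²(ℝ)`. -/
noncomputable def cesaroOp : L2R →L[ℂ] L2R :=
  hausdorffOp cesaroKernel hausdorffKernel_cesaroKernel

theorem cesaroOp_apply_ae (f : L2R) :
    cesaroOp f =ᵐ[volume] fun x : ℝ => ((1 / x : ℝ) : ℂ) * ∫ t in (0 : ℝ)..x, f t := by
  filter_upwards [hausdorffOp_apply_ae _ hausdorffKernel_cesaroKernel f, ae_ne_zero_real]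
    with x h hx
  rw [cesaroOp, h]
  have h1 : ∫ u : ℝ, cesaroKernel u * f (u * x) = ∫ u in (0 : ℝ)..1, f (u * x) := by
    rw [intervalIntegral.integral_of_le zero_le_one, integral_Ioc_eq_integral_Ioo,
      ← integral_indicator measurableSet_Ioo]
    congr 1
    ext u
    by_cases hu : u ∈ Set.Ioo (0 : ℝ) 1
    · simp [cesaroKernel, hu]
    · simp [cesaroKernel, hu]
  rw [h1, intervalIntegral.integral_comp_mul_right _ hx]
  simp [Complex.real_smul]

/-- A bounded operator on `L²(ℝ)` is positive (in the lattice sense) if it maps functions that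
are a.e. real and nonnegative to functions that are a.e. real and nonnegative. -/
def IsPositivityPreserving (S : L2R →L[ℂ] L2R) : Prop :=
  ∀ f : L2R, (∀ᵐ x : ℝ, 0 ≤ (f x).re ∧ (f x).im = 0) →
    ∀ᵐ x : ℝ, 0 ≤ (S f x).re ∧ (S f x).im = 0

/-- `(T t)_{t ≥ 0}` is a strongly continuous (`C₀`) semigroup of bounded operators. -/
structure IsC0Semigroup {E : Type*} [NormedAddCommGroup E] [NormedSpace ℂ E]
    (T : ℝ → E →L[ℂ] E) : Prop where
  map_zero : T 0 = 1
  map_add : ∀ s t : ℝ, 0 ≤ s → 0 ≤ t → T (s + t) = T s * T t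
  tendsto_zero : ∀ x : E, Tendsto (fun t : ℝ => T t x) (𝓝[>] 0) (𝓝 x)

/-- `T`, given on `{0} ∪ {Re z > 0}`, is a holomorphic semigroup in the right half-plane:
the semigroup law holds there, `z ↦ T z` is holomorphic in operator norm for `Re z > 0`, and
`T z x → x` as `z → 0` within every smaller closed sector `|arg z| ≤ δ`, `δ < π / 2`. -/
structure IsHolomorphicSemigroup {E : Type*} [NormedAddCommGroup E] [NormedSpace ℂ E]
    (T : ℂ → E →L[ℂ] E) : Prop where
  map_zero : T 0 = 1
  map_add : ∀ z w : ℂ, (z = 0 ∨ 0 < z.re) → (w = 0 ∨ 0 < w.re) → T (z + w) = T z * T w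
  holomorphic : DifferentiableOn ℂ T {z : ℂ | 0 < z.re}
  tendsto_zero : ∀ δ : ℝ, δ < Real.pi / 2 → ∀ x : E,
    Tendsto (fun z : ℂ => T z x) (𝓝[{z : ℂ | z ≠ 0 ∧ |z.arg| ≤ δ}] 0) (𝓝 x)

/-- The graph of the infinitesimal generator of `(T t)_{t ≥ 0}`: the pairs `(x, y)` with
`(T t x - x) / t → y` as `t → 0+`. -/
def generatorGraph {E : Type*} [NormedAddCommGroup E] [NormedSpace ℂ E]
    (T : ℝ → E →L[ℂ] E) : Submodule ℂ (E × E) where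
  carrier := {p | Tendsto (fun t : ℝ => ((t⁻¹ : ℝ) : ℂ) • (T t p.1 - p.1)) (𝓝[>] 0) (𝓝 p.2)}
  zero_mem' := by simp
  add_mem' := by
    intro p q hp hq
    refine (Tendsto.add hp hq).congr fun t => ?_
    simp only [Prod.fst_add, map_add, ← smul_add]
    congr 1
    abel
  smul_mem' := by
    intro c p hp
    refine (Tendsto.const_smul hp c).congr fun t => ?_
    simp only [Prod.smul_fst, map_smul, ← smul_sub]
    rw [smul_comm]

/-- The infinitesimal generator of `(T t)_{t ≥ 0}`, an unbounded operator whose domain consists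
of the `x` for which `lim_{t → 0+} (T t x - x) / t` exists, with that limit as value. -/
noncomputable def generator {E : Type*} [NormedAddCommGroup E] [NormedSpace ℂ E]
    (T : ℝ → E →L[ℂ] E) : E →ₗ.[ℂ] E :=
  (generatorGraph T).toLinearPMap

theorem generator_graph {E : Type*} [NormedAddCommGroup E] [NormedSpace ℂ E]
    (T : ℝ → E →L[ℂ] E) : (generator T).graph = generatorGraph T := by
  apply Submodule.toLinearPMap_graph_eq
  rintro ⟨x, y⟩ hp hx
  simp only at hx
  subst hx
  refine tendsto_nhds_unique (hp : Tendsto _ _ _) ?_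
  simp

/-- A (possibly unbounded) operator `N` on a Hilbert space is normal if it is closed, densely
defined and `N N* = N* N`, both products having their natural domains. -/
def IsNormalOperator {E : Type*} [NormedAddCommGroup E] [InnerProductSpace ℂ E]
    [CompleteSpace E] (N : E →ₗ.[ℂ] E) : Prop :=
  N.IsClosed ∧ Dense (N.domain : Set E) ∧
    ∀ x z : E, (∃ y : E, (x, y) ∈ N.adjoint.graph ∧ (y, z) ∈ N.graph) ↔
      (∃ y : E, (x, y) ∈ N.graph ∧ (y, z) ∈ N.adjoint.graph)

/-- The spectrum of a (possibly unbounded) operator `A`: the complement of the set of all `z` for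
which `z I - A` is a bijection from the domain of `A` onto `E` with bounded inverse `R`. -/
def operatorSpectrum {E : Type*} [NormedAddCommGroup E] [NormedSpace ℂ E]
    (A : E →ₗ.[ℂ] E) : Set ℂ :=
  {z : ℂ | ∃ R : E →L[ℂ] E, (∀ y : E, ∃ h : R y ∈ A.domain, z • R y - A ⟨R y, h⟩ = y) ∧
    ∀ x : A.domain, R (z • (x : E) - A x) = x}ᶜ

/-! The Cesàro operator `C` and its adjoint have kernels `χ_{(0,1)}(u)` and `χ_{(1,∞)}(v) / v`.
Composing such operators convolves their kernels multiplicatively, and in both orders the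
convolution is `1 / max 1 w` on `w > 0`, which is also the sum of the two kernels. Hence `C C* = C +
C* = C* C`: `C` is normal and `1 - C` is unitary. The spectrum therefore lies on the circle `|1 - z|
= 1`, inside the closed right half-plane, and `Re (1/z) = 1/2` at its nonzero points. Lebesgue
differentiation makes `C` injective, and a normal injective operator has dense range.

To identify `H_α` with `C ^ α`, compare two linear maps on kernels supported in `(0,1)`: the
Hausdorff operator of `K`, and the functional calculus of `C` at the Mellin-type symbol `∫ K(u)
u^(1/z - 1) du`. Because `|u^(1/z - 1)| = u^(-1/2)` on the spectrum, both are bounded by the `L¹`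
norm of `K(u) |u|^(-1/2)`. They agree on monomials, hence on polynomials, hence by density
everywhere (`isCesaroFunction_of_support`). For the Hölder kernel the substitution `u = e^(-t)` and
Euler's integral give the symbol `z ^ α`.

The semigroup statements use only that `C` is normal with dense range and spectrum in `Re z ≥ 0`
(`IsPowerFamily`). A uniform bound on the Taylor remainder of `α ↦ z ^ α` gives norm holomorphy;
since `T z (C y) = T (z + 1) y`, continuity at `0` on the dense range of `C` follows from continuity
at `1`.

The generator is formally `log C`. It is handled through the bounded resolvent `Q`, the functional
calculus at `(w - log z)⁻¹` with value `0` at `z = 0`: the graph is `{(x, y) | x = Q (w x - y)}`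
(`mem_generatorGraph_iff`). This gives closedness and the spectral half-plane. Normality follows
from `Q* = Q U` with `U` a function of `C`, which is possible because the imaginary part of `log z`
is bounded. Positivity is read off from the nonnegative kernel. -/

/-! ### Scalar estimates for `z ^ α` and its derivative in `α` -/

theorem Complex.continuousOn_cpow_const_of_re_nonneg {α : ℂ} (hα : 0 < α.re) {s : Set ℂ}
    (hs : ∀ z ∈ s, 0 ≤ z.re) : ContinuousOn (fun z : ℂ => z ^ α) s := fun z hz =>
  (Complex.continuousAt_cpow_const_of_re_pos (Or.inl (hs z hz)) hα).continuousWithinAt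

/-- The second order Taylor remainder of `α ↦ z ^ α` is bounded uniformly in bounded `z`. -/
theorem Complex.norm_cpow_add_sub_sub_le {α h z : ℂ} {R : ℝ} (hα : 0 < α.re)
    (hh : ‖h‖ ≤ α.re / 4) (hR : 1 ≤ R) (hz : ‖z‖ ≤ R) :
    ‖z ^ (α + h) - z ^ α - h * (z ^ α * Complex.log z)‖ ≤
      (32 / α.re ^ 2 * Real.exp (3 / 2 * α.re * Real.log R + |α.im| * Real.pi +
        α.re * Real.pi / 2)) * ‖h‖ ^ 2 := by
  rcases eq_or_ne z 0 with rfl | hz0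
  · have h1 : 0 < (α + h).re := by
      have := Complex.abs_re_le_norm h
      have := abs_le.1 this
      simp only [Complex.add_re]; linarith
    rw [Complex.zero_cpow (by rintro h0; simp [h0] at h1),
      Complex.zero_cpow (by rintro h0; simp [h0] at hα)]
    simp only [sub_self, zero_mul, mul_zero, norm_zero]
    positivity
  set w := Complex.log z with hw
  set a := α.re with ha
  have hre : w.re = Real.log ‖z‖ := Complex.log_re z
  have him : |w.im| ≤ Real.pi := by rw [hw, Complex.log_im]; exact Complex.abs_arg_le_pi z
  have hx : w.re ≤ Real.log R := by
    rw [hre]; exact Real.log_le_log (norm_pos_iff.2 hz0) hz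
  have hR0 : 0 ≤ Real.log R := Real.log_nonneg hR
  -- With `w = log z` the remainder factors as `e^(αw)` times the second order remainder of the
  -- exponential at `h w`.
  have e1 : z ^ (α + h) - z ^ α - h * (z ^ α * w) =
      Complex.exp (w * α) * (Complex.exp (h * w) - ∑ m ∈ Finset.range 2, (h * w) ^ m / m.factorial) := by
    rw [Complex.cpow_def_of_ne_zero hz0, Complex.cpow_def_of_ne_zero hz0, mul_add, Complex.exp_add]
    simp only [Finset.sum_range_succ, Finset.sum_range_zero, pow_zero, pow_one, Nat.factorial,
      Nat.cast_one, div_one, zero_add, mul_one, mul_comm h w, ← hw]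
    ring
  rw [e1, norm_mul]
  have e2 := Complex.norm_exp_sub_sum_le_norm_mul_exp (h * w) 2
  -- The quadratic term of `exp x` at `x = (a / 4) ‖w‖` gives the constant 32. This factor and `exp
  -- ‖h w‖` each cost `a / 4` in the exponent, so half of the decay `|z| ^ a` near `0` survives.
  have e3 : ‖w‖ ^ 2 ≤ 32 / a ^ 2 * Real.exp (a / 4 * ‖w‖) := by
    have := Real.quadratic_le_exp_of_nonneg (x := a / 4 * ‖w‖) (by positivity)
    have h0 : 0 ≤ a / 4 * ‖w‖ := by positivity
    rw [div_mul_eq_mul_div, le_div_iff₀ (by positivity)]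
    nlinarith
  have e4 : ‖Complex.exp (w * α)‖ = Real.exp (w.re * a - w.im * α.im) := by
    rw [Complex.norm_exp, Complex.mul_re]
  have e5 : ‖w‖ ≤ |w.re| + Real.pi := (Complex.norm_le_abs_re_add_abs_im w).trans (by linarith)
  have e6 : Real.exp (‖h * w‖) ≤ Real.exp (a / 4 * ‖w‖) := by
    rw [norm_mul]; gcongr
  have e7 : w.re * a - w.im * α.im + (a / 4 * ‖w‖ + a / 4 * ‖w‖) ≤
      3 / 2 * a * Real.log R + |α.im| * Real.pi + a * Real.pi / 2 := by
    have h1 : -(w.im * α.im) ≤ |α.im| * Real.pi := by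
      refine (neg_le_abs _).trans ?_
      rw [abs_mul, mul_comm]
      gcongr
    have h2 : a * ‖w‖ ≤ a * (|w.re| + Real.pi) := by gcongr
    have h3 : w.re * a + a / 2 * |w.re| ≤ 3 / 2 * a * Real.log R := by
      rcases le_total 0 w.re with h0 | h0
      · rw [abs_of_nonneg h0]; nlinarith
      · rw [abs_of_nonpos h0]
        have : 0 ≤ 3 / 2 * a * Real.log R := by positivity
        nlinarith
    nlinarith
  calc _ ≤ Real.exp (w.re * a - w.im * α.im) * (‖h * w‖ ^ 2 * Real.exp ‖h * w‖) := by
        rw [e4]; gcongr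
    _ ≤ Real.exp (w.re * a - w.im * α.im) *
        ((‖h‖ ^ 2 * (32 / a ^ 2 * Real.exp (a / 4 * ‖w‖))) * Real.exp (a / 4 * ‖w‖)) := by
        rw [norm_mul, mul_pow, ← norm_mul]
        gcongr
    _ = 32 / a ^ 2 * Real.exp (w.re * a - w.im * α.im + (a / 4 * ‖w‖ + a / 4 * ‖w‖)) * ‖h‖ ^ 2 := by
        rw [Real.exp_add, Real.exp_add]; ring
    _ ≤ _ := by gcongr

/-- The difference quotients in the exponent are continuous in `z`, and by the remainder bound they
converge uniformly on bounded sets. This avoids a separate discussion of the singularity of `log` at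
`0`. -/
theorem Complex.continuousOn_cpow_mul_log {α : ℂ} (hα : 0 < α.re) {s : Set ℂ}
    (hs : ∀ z ∈ s, 0 ≤ z.re) {R : ℝ} (hR : 1 ≤ R) (hsR : ∀ z ∈ s, ‖z‖ ≤ R) :
    ContinuousOn (fun z : ℂ => z ^ α * Complex.log z) s := by
  refine continuousOn_of_uniform_approx_of_continuousOn fun u hu => ?_
  obtain ⟨ε, hε, hu⟩ := Metric.mem_uniformity_dist.1 hu
  set c := 32 / α.re ^ 2 * Real.exp (3 / 2 * α.re * Real.log R + |α.im| * Real.pi +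
        α.re * Real.pi / 2) with hc
  have hc0 : 0 < c := by positivity
  -- The first bound admits `r` in the remainder estimate; the second makes the error `c * r` at
  -- most `ε / 2`.
  set r : ℝ := min (α.re / 4) (ε / (2 * c)) with hr
  have hr0 : 0 < r := by positivity
  have hα' : 0 < (α + (r : ℂ)).re := by simp; linarith
  refine ⟨fun z => (r : ℂ)⁻¹ * (z ^ (α + r) - z ^ α), ?_, fun z hz => hu ?_⟩
  · exact continuousOn_const.mul ((continuousOn_cpow_const_of_re_nonneg hα' hs).sub
      (continuousOn_cpow_const_of_re_nonneg hα hs))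
  · have hn : ‖(r : ℂ)‖ = r := by rw [Complex.norm_real, Real.norm_of_nonneg hr0.le]
    have := norm_cpow_add_sub_sub_le (h := r) hα (by rw [hn]; exact min_le_left _ _) hR (hsR z hz)
    rw [hn, ← hc] at this
    have hrc : (r : ℂ) ≠ 0 := by exact_mod_cast hr0.ne'
    rw [dist_eq_norm]
    have e : z ^ α * Complex.log z - (r : ℂ)⁻¹ * (z ^ (α + r) - z ^ α) =
      -((r : ℂ)⁻¹ * (z ^ (α + r) - z ^ α - r * (z ^ α * Complex.log z))) := by
      field_simp; ring
    rw [e, norm_neg, norm_mul, norm_inv, hn]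
    calc r⁻¹ * _ ≤ r⁻¹ * (c * r ^ 2) := by gcongr
      _ = c * r := by field_simp
      _ ≤ c * (ε / (2 * c)) := by gcongr; exact min_le_right _ _
      _ = ε / 2 := by field_simp
      _ < ε := by linarith

/-! ### Powers in the functional calculus: exponent law and holomorphy -/

section Powers

variable {A : Type*} [CStarAlgebra A]

theorem spectrum.exists_one_le_forall_norm_le (C : A) :
    ∃ R : ℝ, 1 ≤ R ∧ ∀ z ∈ spectrum ℂ C, ‖z‖ ≤ R := by
  obtain ⟨R, hR⟩ := (spectrum.isBounded (𝕜 := ℂ) C).exists_norm_le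
  exact ⟨max 1 R, le_max_left _ _, fun z hz => (hR z hz).trans (le_max_right _ _)⟩

theorem cfc_cpow_add {C : A} (hs : ∀ z ∈ spectrum ℂ C, 0 ≤ z.re) {α β : ℂ}
    (hα : 0 < α.re) (hβ : 0 < β.re) :
    cfc (fun z : ℂ => z ^ (α + β)) C =
      cfc (fun z : ℂ => z ^ α) C * cfc (fun z : ℂ => z ^ β) C := by
  rw [← cfc_mul _ _ C (Complex.continuousOn_cpow_const_of_re_nonneg hα hs)
    (Complex.continuousOn_cpow_const_of_re_nonneg hβ hs)]
  refine cfc_congr fun z _ => ?_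
  rcases eq_or_ne z 0 with rfl | hz
  · have h1 : α + β ≠ 0 := fun h => by
      have := congrArg Complex.re h; simp at this; linarith
    have h2 : α ≠ 0 := fun h => by simp [h] at hα
    simp only [Complex.zero_cpow h1, Complex.zero_cpow h2, zero_mul]
  · exact Complex.cpow_add _ _ hz

/-- The functional calculus does not increase sup norms on the spectrum, so the uniform scalar
remainder `O(‖h‖²)` transfers to the operator norm. -/
theorem hasDerivAt_cfc_cpow {C : A} [IsStarNormal C] (hs : ∀ z ∈ spectrum ℂ C, 0 ≤ z.re) {α : ℂ}
    (hα : 0 < α.re) :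
    HasDerivAt (fun α : ℂ => cfc (fun z : ℂ => z ^ α) C)
      (cfc (fun z : ℂ => z ^ α * Complex.log z) C) α := by
  obtain ⟨R, hR, hsR⟩ := spectrum.exists_one_le_forall_norm_le C
  rw [hasDerivAt_iff_isLittleO_nhds_zero]
  have hO : (fun h : ℂ => cfc (fun z : ℂ => z ^ (α + h)) C - cfc (fun z : ℂ => z ^ α) C -
      h • cfc (fun z : ℂ => z ^ α * Complex.log z) C) =O[𝓝 0] fun h : ℂ => ‖h‖ ^ 2 := by
    refine Asymptotics.IsBigO.of_bound (32 / α.re ^ 2 * Real.exp (3 / 2 * α.re * Real.log R +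
      |α.im| * Real.pi + α.re * Real.pi / 2)) ?_
    filter_upwards [Metric.closedBall_mem_nhds (0 : ℂ) (by positivity : 0 < α.re / 4)] with h hh
    rw [mem_closedBall_zero_iff] at hh
    have h1 : 0 < (α + h).re := by
      have := abs_le.1 (Complex.abs_re_le_norm h)
      simp only [Complex.add_re]; linarith
    have c1 := Complex.continuousOn_cpow_const_of_re_nonneg h1 hs
    have c2 := Complex.continuousOn_cpow_const_of_re_nonneg hα hs
    have c3 := Complex.continuousOn_cpow_mul_log hα hs hR hsR
    rw [← cfc_sub _ _ C c1 c2, ← cfc_const_mul h _ C c3,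
      ← cfc_sub (fun z : ℂ => z ^ (α + h) - z ^ α) (fun z : ℂ => h * (z ^ α * Complex.log z)) C
        (c1.sub c2) (continuousOn_const.mul c3)]
    rw [Real.norm_of_nonneg (by positivity : 0 ≤ ‖h‖ ^ 2)]
    exact norm_cfc_le (by positivity) fun z hz =>
      Complex.norm_cpow_add_sub_sub_le hα hh hR (hsR z hz)
  refine hO.trans_isLittleO ?_
  have := Asymptotics.isLittleO_norm_pow_id (E' := ℂ) (n := 2) (by norm_num)
  exact this

end Powers

/-! ### Power families as holomorphic and strongly continuous semigroups -/

theorem tendsto_apply_of_dense_of_bounded {E ι : Type*} [NormedAddCommGroup E] [NormedSpace ℂ E] {l : Filter ι} {S : ι → E →L[ℂ] E}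
    {L : E →L[ℂ] E} {B : ℝ} {D : Set E} (hB : ∀ᶠ i in l, ‖S i‖ ≤ B) (hD : Dense D)
    (h : ∀ x ∈ D, Tendsto (fun i => S i x) l (𝓝 (L x))) (x : E) :
    Tendsto (fun i => S i x) l (𝓝 (L x)) := by
  rw [Metric.tendsto_nhds]
  intro ε hε
  set c : ℝ := |B| + ‖L‖ + 1 with hc
  have hc0 : 0 < c := by positivity
  obtain ⟨y, hy, hxy⟩ := hD.exists_dist_lt x (by positivity : 0 < ε / (2 * c))
  filter_upwards [hB, Metric.tendsto_nhds.1 (h y hy) (ε / 2) (by positivity)] with i h1 h2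
  rw [dist_eq_norm] at h2 hxy ⊢
  have e : S i x - L x = S i (x - y) - L (x - y) + (S i y - L y) := by
    simp only [map_sub]; abel
  have h3 : ‖S i (x - y)‖ ≤ |B| * ‖x - y‖ :=
    (ContinuousLinearMap.le_opNorm _ _).trans
      (mul_le_mul_of_nonneg_right (h1.trans (le_abs_self B)) (norm_nonneg _))
  have h4 : ‖L (x - y)‖ ≤ ‖L‖ * ‖x - y‖ := ContinuousLinearMap.le_opNorm _ _
  have h5 : c * ‖x - y‖ ≤ ε / 2 := by
    calc c * ‖x - y‖ ≤ c * (ε / (2 * c)) := by gcongr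
      _ = ε / 2 := by field_simp
  have h6 := norm_add_le (S i (x - y) - L (x - y)) (S i y - L y)
  have h7 := norm_sub_le (S i (x - y)) (L (x - y))
  rw [e]
  have h8 := norm_nonneg (x - y)
  nlinarith

section Powers

variable {E : Type*} [NormedAddCommGroup E] [InnerProductSpace ℂ E] [CompleteSpace E]

/-- `T` is the family of powers `C ^ α`, `α = 0` or `Re α > 0`, of a normal operator `C` with dense
range and spectrum in the closed right half-plane. -/
structure IsPowerFamily (C : E →L[ℂ] E) (T : ℂ → E →L[ℂ] E) : Prop where
  normal : IsStarNormal C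
  re_nonneg : ∀ z ∈ spectrum ℂ C, 0 ≤ z.re
  denseRange : DenseRange C
  map_zero : T 0 = 1
  eq_cfc : ∀ α : ℂ, 0 < α.re → T α = cfc (fun z : ℂ => z ^ α) C

namespace IsPowerFamily

variable {C : E →L[ℂ] E} {T : ℂ → E →L[ℂ] E}

theorem map_one (h : IsPowerFamily C T) : T 1 = C := by
  have := h.normal
  rw [h.eq_cfc 1 (by simp)]
  simp only [Complex.cpow_one]
  exact cfc_id' ℂ C

theorem map_add (h : IsPowerFamily C T) {z w : ℂ} (hz : z = 0 ∨ 0 < z.re)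
    (hw : w = 0 ∨ 0 < w.re) : T (z + w) = T z * T w := by
  rcases hz with rfl | hz
  · rw [zero_add, h.map_zero, one_mul]
  rcases hw with rfl | hw
  · rw [add_zero, h.map_zero, mul_one]
  rw [h.eq_cfc z hz, h.eq_cfc w hw, h.eq_cfc (z + w) (by simp; positivity)]
  exact cfc_cpow_add h.re_nonneg hz hw

theorem hasDerivAt (h : IsPowerFamily C T) {α : ℂ} (hα : 0 < α.re) :
    HasDerivAt T (cfc (fun z : ℂ => z ^ α * Complex.log z) C) α := by
  have := h.normal
  refine (hasDerivAt_cfc_cpow h.re_nonneg hα).congr_of_eventuallyEq ?_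
  filter_upwards [(isOpen_lt continuous_const Complex.continuous_re).mem_nhds hα] with β hβ
  exact h.eq_cfc β hβ

/-- On the spectrum `|z ^ α| = |z| ^ (Re α) e^(-arg z · Im α)`, and for `‖α‖ ≤ 1` the two factors
are at most `R` and `e^π`. This is the uniform bound behind strong continuity at `0`. -/
theorem norm_le (h : IsPowerFamily C T) {R : ℝ} (hR : 1 ≤ R) (hsR : ∀ z ∈ spectrum ℂ C, ‖z‖ ≤ R)
    {α : ℂ} (hα : 0 < α.re) (hα1 : ‖α‖ ≤ 1) : ‖T α‖ ≤ R * Real.exp Real.pi := by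
  rw [h.eq_cfc α hα]
  refine norm_cfc_le (by positivity) fun z hz => ?_
  rcases eq_or_ne z 0 with rfl | hz0
  · rw [Complex.zero_cpow (by rintro rfl; simp at hα)]
    simp only [norm_zero]; positivity
  rw [Complex.norm_cpow_of_ne_zero hz0, div_eq_mul_inv, ← Real.exp_neg]
  have h1 : ‖z‖ ^ α.re ≤ R := by
    refine (Real.rpow_le_rpow (norm_nonneg z) (hsR z hz) hα.le).trans ?_
    refine (Real.rpow_le_rpow_of_exponent_le hR
      ((Complex.re_le_norm α).trans hα1)).trans_eq (Real.rpow_one R)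
  have h2 : -(z.arg * α.im) ≤ Real.pi := by
    refine (neg_le_abs _).trans ?_
    rw [abs_mul]
    calc |z.arg| * |α.im| ≤ Real.pi * 1 := by
          gcongr
          · exact Complex.abs_arg_le_pi z
          · exact (Complex.abs_im_le_norm α).trans hα1
      _ = _ := mul_one _
  gcongr

theorem isHolomorphicSemigroup (h : IsPowerFamily C T) : IsHolomorphicSemigroup T where
  map_zero := h.map_zero
  map_add _ _ hz hw := h.map_add hz hw
  holomorphic α hα := (h.hasDerivAt hα).differentiableAt.differentiableWithinAt
  tendsto_zero δ hδ x := by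
    obtain ⟨R, hR, hsR⟩ := spectrum.exists_one_le_forall_norm_le C
    have hre : ∀ᶠ z in 𝓝[{z : ℂ | z ≠ 0 ∧ |z.arg| ≤ δ}] 0, 0 < z.re := by
      filter_upwards [self_mem_nhdsWithin] with z hz
      exact (Complex.abs_arg_lt_pi_div_two_iff.1 (hz.2.trans_lt hδ)).resolve_right hz.1
    refine tendsto_apply_of_dense_of_bounded (L := 1) (B := R * Real.exp Real.pi) (D := Set.range C)
      ?_ h.denseRange ?_ x
    · filter_upwards [hre, nhdsWithin_le_nhds (Metric.closedBall_mem_nhds (0 : ℂ) one_pos)]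
        with z hz hz1
      exact h.norm_le hR hsR hz (mem_closedBall_zero_iff.1 hz1)
    · rintro _ ⟨y, rfl⟩
      -- On the range of `C = T 1` the limit at `0` becomes norm continuity of `T` at the interior
      -- point `1`.
      have h1 : Tendsto (fun z : ℂ => T (z + 1) y) (𝓝 0) (𝓝 (C y)) := by
        have h2 := (h.hasDerivAt (α := 1) (by simp)).continuousAt.tendsto
        rw [h.map_one] at h2
        have h3 : Tendsto (fun z : ℂ => z + 1) (𝓝 0) (𝓝 1) :=
          (by fun_prop : Continuous fun z : ℂ => z + 1).tendsto' 0 1 (by simp)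
        exact ((ContinuousLinearMap.apply ℂ E y).continuous.tendsto _).comp (h2.comp h3)
      refine (h1.mono_left nhdsWithin_le_nhds).congr' ?_
      filter_upwards [hre] with z hz
      rw [h.map_add (Or.inr hz) (Or.inr (by simp)), h.map_one]
      rfl

theorem isC0Semigroup (h : IsPowerFamily C T) : IsC0Semigroup fun t : ℝ => T (t : ℂ) where
  map_zero := by simpa using h.map_zero
  map_add s t hs ht := by
    have key : ∀ r : ℝ, 0 ≤ r → (r : ℂ) = 0 ∨ 0 < (r : ℂ).re := fun r hr => by
      rcases hr.eq_or_lt with rfl | hr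
      · simp
      · right; simpa using hr
    rw [Complex.ofReal_add]
    exact h.map_add (key s hs) (key t ht)
  tendsto_zero x := by
    -- The positive half-line is the degenerate sector `δ = 0`.
    have h1 := h.isHolomorphicSemigroup.tendsto_zero 0 (by positivity) x
    refine h1.comp (tendsto_nhdsWithin_iff.2 ⟨?_, ?_⟩)
    · have := Complex.continuous_ofReal.tendsto (0 : ℝ)
      rw [Complex.ofReal_zero] at this
      exact this.mono_left nhdsWithin_le_nhds
    · filter_upwards [self_mem_nhdsWithin] with t ht
      have ht : 0 < t := ht
      exact ⟨by exact_mod_cast ht.ne', by rw [Complex.arg_ofReal_of_nonneg ht.le]; simp⟩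

end IsPowerFamily

end Powers

/-! ### The resolvent function of the logarithm -/

/-- The function `z ↦ (w - log z)⁻¹`, with value `0` at `z = 0`. -/
noncomputable def logResolvent (w z : ℂ) : ℂ := if z = 0 then 0 else (w - Complex.log z)⁻¹

theorem logResolvent_zero (w : ℂ) : logResolvent w 0 = 0 := if_pos rfl

theorem logResolvent_of_ne_zero (w : ℂ) {z : ℂ} (hz : z ≠ 0) :
    logResolvent w z = (w - Complex.log z)⁻¹ := if_neg hz

theorem sub_log_re_le_norm (w z : ℂ) : w.re - Real.log ‖z‖ ≤ ‖w - Complex.log z‖ := by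
  have := Complex.re_le_norm (w - Complex.log z)
  simpa [Complex.log_re] using this

theorem sub_log_norm_pos {w z : ℂ} {R : ℝ} (hw : Real.log R < w.re) (hz : ‖z‖ ≤ R) (hz0 : z ≠ 0) :
    0 < w.re - Real.log ‖z‖ := by
  have := Real.log_le_log (norm_pos_iff.2 hz0) hz
  linarith

theorem sub_log_ne_zero {w z : ℂ} {R : ℝ} (hw : Real.log R < w.re) (hz : ‖z‖ ≤ R) (hz0 : z ≠ 0) :
    w - Complex.log z ≠ 0 :=
  norm_pos_iff.1 ((sub_log_norm_pos hw hz hz0).trans_le (sub_log_re_le_norm w z))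

/-- Since `|w - log z| ≥ Re w - log |z|` tends to infinity as `z → 0`, the value `0` is the
continuous extension. -/
theorem tendsto_logResolvent_zero (w : ℂ) : Tendsto (logResolvent w) (𝓝 0) (𝓝 0) := by
  have h1 : Tendsto (logResolvent w) (𝓝[≠] 0) (𝓝 0) := by
    have h2 : Tendsto (fun z : ℂ => w.re - Real.log ‖z‖) (𝓝[≠] 0) atTop := by
      have h3 : Tendsto (fun z : ℂ => Real.log ‖z‖) (𝓝[≠] 0) atBot :=
        Real.tendsto_log_nhdsGT_zero.comp tendsto_norm_nhdsNE_zero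
      exact tendsto_atTop_add_const_left _ _ (tendsto_neg_atBot_atTop.comp h3)
    refine squeeze_zero_norm' ?_ (tendsto_inv_atTop_zero.comp h2)
    filter_upwards [self_mem_nhdsWithin, h2.eventually_gt_atTop 0] with z hz h4
    rw [logResolvent_of_ne_zero w hz, norm_inv]
    exact inv_anti₀ h4 (sub_log_re_le_norm w z)
  refine Tendsto.mono_left (tendsto_sup.2 ⟨h1, ?_⟩) (nhdsNE_sup_pure (0 : ℂ)).ge
  rw [tendsto_pure_left]
  intro s hs
  rw [logResolvent_zero]
  exact mem_of_mem_nhds hs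

theorem mem_slitPlane_of_re_nonneg {z : ℂ} (hz : 0 ≤ z.re) (hz0 : z ≠ 0) :
    z ∈ Complex.slitPlane := by
  rw [Complex.mem_slitPlane_iff]
  by_contra! h
  exact hz0 (Complex.ext (le_antisymm h.1 hz) h.2)

theorem continuousOn_logResolvent {w : ℂ} {R : ℝ} (hw : Real.log R < w.re) {s : Set ℂ}
    (hs : ∀ z ∈ s, 0 ≤ z.re) (hsR : ∀ z ∈ s, ‖z‖ ≤ R) : ContinuousOn (logResolvent w) s := by
  intro z hz
  refine ContinuousAt.continuousWithinAt ?_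
  rcases eq_or_ne z 0 with rfl | hz0
  · rw [ContinuousAt, logResolvent_zero]
    exact tendsto_logResolvent_zero w
  · have h1 : ContinuousAt (fun z => (w - Complex.log z)⁻¹) z :=
      (continuousAt_const.sub (continuousAt_clog (mem_slitPlane_of_re_nonneg (hs z hz) hz0))).inv₀
        (sub_log_ne_zero hw (hsR z hz) hz0)
    refine h1.congr ?_
    filter_upwards [isOpen_ne.mem_nhds hz0] with y hy
    exact (logResolvent_of_ne_zero w hy).symm

/-- The unimodular function `z ↦ (w - log z) / conj (w - log z)`, `w` real. -/
noncomputable def logPhase (w : ℝ) (z : ℂ) : ℂ :=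
  1 - 2 * Complex.I * (z.arg * star (logResolvent w z))

/-- Away from `0` the half-plane meets only the slit plane, where `arg` is continuous. At `0` the
argument jumps but stays bounded by `π`, and the resolvent factor tends to `0`. -/
theorem continuousOn_logPhase {w R : ℝ} (hw : Real.log R < w) {s : Set ℂ}
    (hs : ∀ z ∈ s, 0 ≤ z.re) (hsR : ∀ z ∈ s, ‖z‖ ≤ R) : ContinuousOn (logPhase w) s := by
  have hr := continuousOn_logResolvent (w := w) (by simpa using hw) hs hsR
  refine continuousOn_const.sub (continuousOn_const.mul fun z hz => ?_)
  rcases eq_or_ne z 0 with rfl | hz0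
  · refine ContinuousAt.continuousWithinAt ?_
    rw [ContinuousAt, logResolvent_zero, star_zero, mul_zero]
    have h1 := (tendsto_logResolvent_zero (w : ℂ)).norm.const_mul Real.pi
    rw [norm_zero, mul_zero] at h1
    refine squeeze_zero_norm (fun z => ?_) h1
    rw [norm_mul, norm_star, Complex.norm_real, Real.norm_eq_abs]
    gcongr
    exact Complex.abs_arg_le_pi z
  · refine ContinuousWithinAt.mul ?_ (hr z hz).star
    exact (Complex.continuous_ofReal.continuousAt.comp (Complex.continuousAt_arg
      (mem_slitPlane_of_re_nonneg (hs z hz) hz0))).continuousWithinAt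

theorem logResolvent_mul_logPhase {w R : ℝ} (hw : Real.log R < w) {z : ℂ} (hz : ‖z‖ ≤ R) :
    logResolvent w z * logPhase w z = star (logResolvent w z) := by
  rcases eq_or_ne z 0 with rfl | hz0
  · simp [logResolvent_zero]
  have h1 := sub_log_ne_zero (w := w) (by simpa using hw) hz hz0
  have h2 : star ((w : ℂ) - Complex.log z) ≠ 0 := star_ne_zero.2 h1
  -- For real `w` the difference from the conjugate is purely `-2i arg z`; this is where the reality
  -- of `w` enters.
  have h3 : (w : ℂ) - Complex.log z - star ((w : ℂ) - Complex.log z) =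
      -(2 * Complex.I * z.arg) := by
    rw [← Complex.log_im]
    apply Complex.ext <;> simp
    ring
  rw [logPhase, logResolvent_of_ne_zero _ hz0, star_inv₀]
  field_simp
  linear_combination -h3

/-- Difference quotients of `t ↦ z ^ t` at `0`, multiplied by `(w - log z)⁻¹`, are bounded. -/
theorem norm_cpow_sub_one_div_mul_logResolvent_le {w z : ℂ} {R t : ℝ} (hR : 1 ≤ R)
    (hw : Real.log R < w.re) (hz : ‖z‖ ≤ R) (ht : 0 < t) (ht1 : t ≤ 1) :
    ‖((t⁻¹ : ℝ) : ℂ) * ((z ^ (t : ℂ) - 1) * logResolvent w z)‖ ≤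
      R * (1 + ‖w‖ / (w.re - Real.log R)) := by
  have hd : 0 < w.re - Real.log R := by linarith
  rcases eq_or_ne z 0 with rfl | hz0
  · rw [logResolvent_zero]
    simp only [mul_zero, norm_zero]
    positivity
  set l := Complex.log z with hl
  have h1 : w - l ≠ 0 := sub_log_ne_zero hw hz hz0
  have h2 : w.re - Real.log R ≤ ‖w - l‖ := by
    refine le_trans ?_ (sub_log_re_le_norm w z)
    have := Real.log_le_log (norm_pos_iff.2 hz0) hz
    linarith
  have h3 : ‖l * (w - l)⁻¹‖ ≤ 1 + ‖w‖ / (w.re - Real.log R) := by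
    have : l * (w - l)⁻¹ = w * (w - l)⁻¹ - 1 := by field_simp; ring
    rw [this, add_comm]
    refine (norm_sub_le _ _).trans ?_
    rw [norm_mul, norm_inv, norm_one, div_eq_mul_inv]
    gcongr
  have h4 : ‖z ^ (t : ℂ) - 1‖ ≤ R * (t * ‖l‖) := by
    -- Mean value inequality for `exp` between `0` and `t log z`, both in the half-plane `Re y ≤ log
    -- R`, where `|exp'| ≤ R`.
    have := Convex.norm_image_sub_le_of_norm_deriv_le (𝕜 := ℂ) (f := Complex.exp)
      (s := {y : ℂ | y.re ≤ Real.log R}) (x := 0) (y := l * t) (C := R)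
      (fun y _ => Complex.differentiableAt_exp) (fun y hy => ?_)
      (convex_halfSpace_re_le _) ?_ ?_
    · rw [Complex.cpow_def_of_ne_zero hz0]
      rw [Complex.exp_zero, sub_zero, norm_mul, Complex.norm_real, Real.norm_of_nonneg ht.le,
        mul_comm ‖l‖] at this
      exact this
    · rw [Complex.deriv_exp, Complex.norm_exp]
      refine (Real.exp_le_exp.2 hy).trans_eq (Real.exp_log (by linarith))
    · simpa using Real.log_nonneg hR
    · have h5 : l.re ≤ Real.log R := by
        rw [hl, Complex.log_re]; exact Real.log_le_log (norm_pos_iff.2 hz0) hz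
      have h6 := Real.log_nonneg hR
      simp only [Set.mem_ofPred_eq, Complex.re_mul_ofReal]
      nlinarith
  rw [logResolvent_of_ne_zero _ hz0, norm_mul, norm_mul, Complex.norm_real,
    Real.norm_of_nonneg (by positivity : 0 ≤ t⁻¹)]
  calc t⁻¹ * (‖z ^ (t : ℂ) - 1‖ * ‖(w - l)⁻¹‖) ≤ t⁻¹ * (R * (t * ‖l‖) * ‖(w - l)⁻¹‖) := by gcongr
    _ = R * ‖l * (w - l)⁻¹‖ := by rw [norm_mul]; field_simp
    _ ≤ _ := by gcongr

/-! ### The generator: resolvent, adjoint, normality, spectrum -/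

namespace IsPowerFamily

variable {E : Type*} [NormedAddCommGroup E] [InnerProductSpace ℂ E] [CompleteSpace E]
variable {C : E →L[ℂ] E} {T : ℂ → E →L[ℂ] E}

theorem commute_cfc (h : IsPowerFamily C T) {t : ℝ} (ht : 0 < t) (f : ℂ → ℂ) :
    T t * cfc f C = cfc f C * T t := by
  rw [h.eq_cfc t (by simpa using ht)]
  exact cfc_commute_cfc _ _ C

theorem diffQuot_mul_cfc_logResolvent (h : IsPowerFamily C T) {R : ℝ}
    (hsR : ∀ z ∈ spectrum ℂ C, ‖z‖ ≤ R) {w : ℂ} (hw : Real.log R < w.re) {t : ℝ} (ht : 0 < t) :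
    ((t⁻¹ : ℝ) : ℂ) • ((T t - 1) * cfc (logResolvent w) C) =
      cfc (fun z => ((t⁻¹ : ℝ) : ℂ) * ((z ^ (t : ℂ) - 1) * logResolvent w z)) C := by
  have := h.normal
  have c1 := Complex.continuousOn_cpow_const_of_re_nonneg (α := t) (by simpa using ht) h.re_nonneg
  have c2 := continuousOn_logResolvent hw h.re_nonneg hsR
  have c3 : ContinuousOn (fun z : ℂ => z ^ (t : ℂ) - 1) (spectrum ℂ C) := c1.sub continuousOn_const
  rw [cfc_const_mul _ (fun z : ℂ => (z ^ (t : ℂ) - 1) * logResolvent w z) C (c3.mul c2),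
    cfc_mul (fun z : ℂ => z ^ (t : ℂ) - 1) _ C c3 c2,
    cfc_sub (fun z : ℂ => z ^ (t : ℂ)) (fun _ => 1) C c1 continuousOn_const, cfc_const_one ℂ C,
    h.eq_cfc t (by simpa using ht)]

/-- The identity `log z / (w - log z) = w / (w - log z) - 1`, multiplied by `z` so that every
function involved is continuous at `0`. -/
theorem cfc_mul_log_mul_cfc_logResolvent (h : IsPowerFamily C T) {R : ℝ} (hR : 1 ≤ R)
    (hsR : ∀ z ∈ spectrum ℂ C, ‖z‖ ≤ R) {w : ℂ} (hw : Real.log R < w.re) :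
    cfc (fun z : ℂ => z ^ (1 : ℂ) * Complex.log z) C * cfc (logResolvent w) C =
      (w • cfc (logResolvent w) C - 1) * C := by
  have := h.normal
  have c1 := Complex.continuousOn_cpow_mul_log (α := 1) (by simp) h.re_nonneg hR hsR
  have c2 := continuousOn_logResolvent hw h.re_nonneg hsR
  have c3 : ContinuousOn (fun z : ℂ => w * logResolvent w z) (spectrum ℂ C) :=
    continuousOn_const.mul c2
  have e : (w • cfc (logResolvent w) C - 1) * C =
      cfc (fun z => (w * logResolvent w z - 1) * z) C := by
    rw [cfc_mul (fun z => w * logResolvent w z - 1) (fun z => z) C (c3.sub continuousOn_const)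
        continuousOn_id,
      cfc_sub (fun z => w * logResolvent w z) (fun _ => 1) C c3 continuousOn_const,
      cfc_const_one ℂ C, cfc_const_mul _ _ C c2, cfc_id' ℂ C]
  rw [← cfc_mul _ _ C c1 c2, e]
  refine cfc_congr fun z hz => ?_
  rcases eq_or_ne z 0 with rfl | hz0
  · simp
  have h1 := sub_log_ne_zero hw (hsR z hz) hz0
  simp only [logResolvent_of_ne_zero _ hz0, Complex.cpow_one]
  field_simp
  ring

/-- `t⁻¹ (T t x - x) → T'(1) y` for `x = C y`. -/
theorem mem_generatorGraph_apply (h : IsPowerFamily C T) (y : E) :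
    (C y, cfc (fun z : ℂ => z ^ (1 : ℂ) * Complex.log z) C y) ∈
      generatorGraph fun t : ℝ => T (t : ℂ) := by
  have h1 := (h.hasDerivAt (α := 1) (by simp)).tendsto_slope_zero
  have h2 : Tendsto (fun t : ℝ => (t : ℂ)) (𝓝[>] 0) (𝓝[≠] 0) := by
    refine tendsto_nhdsWithin_iff.2 ⟨?_, ?_⟩
    · exact (Complex.continuous_ofReal.tendsto' 0 0 (by simp)).mono_left nhdsWithin_le_nhds
    · filter_upwards [self_mem_nhdsWithin] with t ht
      exact Complex.ofReal_ne_zero.2 (ne_of_gt ht)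
  have h3 := ((ContinuousLinearMap.apply ℂ E y).continuous.tendsto _).comp (h1.comp h2)
  refine h3.congr' ?_
  filter_upwards [self_mem_nhdsWithin] with t ht
  have ht : 0 < t := ht
  simp only [Function.comp_apply, ContinuousLinearMap.apply_apply]
  rw [add_comm, h.map_add (Or.inr (by simpa using ht)) (Or.inr (by simp)), h.map_one,
    Complex.ofReal_inv]
  simp

/-- The difference quotients composed with the resolvent are uniformly bounded for `0 < t ≤ 1`, and
their limit is known on the dense range of `C`; hence they converge everywhere. -/
theorem cfc_logResolvent_mem_generatorGraph (h : IsPowerFamily C T) {R : ℝ} (hR : 1 ≤ R)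
    (hsR : ∀ z ∈ spectrum ℂ C, ‖z‖ ≤ R) {w : ℂ} (hw : Real.log R < w.re) (x : E) :
    (cfc (logResolvent w) C x, w • cfc (logResolvent w) C x - x) ∈
      generatorGraph fun t : ℝ => T (t : ℂ) := by
  have hcomm : Commute C (cfc (logResolvent w) C) := by
    have := h.normal
    have := cfc_commute_cfc (fun z : ℂ => z) (logResolvent w) C
    rwa [cfc_id' ℂ C] at this
  have key := tendsto_apply_of_dense_of_bounded (l := 𝓝[>] (0 : ℝ))
    (S := fun t : ℝ => ((t⁻¹ : ℝ) : ℂ) • ((T t - 1) * cfc (logResolvent w) C))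
    (L := w • cfc (logResolvent w) C - 1) (D := Set.range C)
    (B := R * (1 + ‖w‖ / (w.re - Real.log R))) ?_ h.denseRange ?_ x
  · simpa [generatorGraph] using key
  · filter_upwards [Ioc_mem_nhdsGT (one_pos : (0 : ℝ) < 1)] with t ht
    rw [h.diffQuot_mul_cfc_logResolvent hsR hw ht.1]
    have : 0 < w.re - Real.log R := by linarith
    exact norm_cfc_le (by positivity) fun z hz =>
      norm_cpow_sub_one_div_mul_logResolvent_le hR hw (hsR z hz) ht.1 ht.2
  · rintro _ ⟨y, rfl⟩
    have h1 : Tendsto _ _ _ := h.mem_generatorGraph_apply (cfc (logResolvent w) C y)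
    have h2 := congrArg (· y) (h.cfc_mul_log_mul_cfc_logResolvent hR hsR hw)
    simp only [mul_apply_eq_comp] at h2
    rw [← h2]
    refine h1.congr fun t => ?_
    have h3 := congrArg (· y) hcomm.eq
    simp only [mul_apply_eq_comp] at h3
    simp [h3]

/-- Here the unbounded generator is encoded by one bounded operator. If the difference quotients at
`x` converge, applying the resolvent, which commutes with `T t`, and comparing with the limit
already known at the resolvent of `x` forces the equation. -/
theorem mem_generatorGraph_iff (h : IsPowerFamily C T) {R : ℝ} (hR : 1 ≤ R)
    (hsR : ∀ z ∈ spectrum ℂ C, ‖z‖ ≤ R) {w : ℂ} (hw : Real.log R < w.re) (x y : E) :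
    (x, y) ∈ (generatorGraph fun t : ℝ => T (t : ℂ)) ↔ x = cfc (logResolvent w) C (w • x - y) := by
  constructor
  · intro hxy
    have h1 := (((cfc (logResolvent w) C).continuous.tendsto _).comp
      (hxy : Tendsto (fun t : ℝ => ((t⁻¹ : ℝ) : ℂ) • (T t x - x)) _ (𝓝 y)))
    have h2 : Tendsto (fun t : ℝ => ((t⁻¹ : ℝ) : ℂ) • (T t (cfc (logResolvent w) C x) -
      cfc (logResolvent w) C x)) (𝓝[>] 0) (𝓝 _) := h.cfc_logResolvent_mem_generatorGraph hR hsR hw x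
    have h3 := tendsto_nhds_unique h2 (h1.congr' (by
      filter_upwards [self_mem_nhdsWithin] with t ht
      have := congrArg (· x) (h.commute_cfc ht (logResolvent w))
      simp only [mul_apply_eq_comp] at this
      simp [this]))
    simp only at h3
    rw [map_sub, map_smul, ← h3, sub_sub_cancel]
  · intro hx
    have := h.cfc_logResolvent_mem_generatorGraph hR hsR hw (w • x - y)
    rw [← hx] at this
    simpa using this

theorem dense_generator_domain (h : IsPowerFamily C T) :
    Dense ((generator fun t : ℝ => T (t : ℂ)).domain : Set E) := by
  refine h.denseRange.mono ?_
  rintro _ ⟨y, rfl⟩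
  have := h.mem_generatorGraph_apply y
  rw [← generator_graph] at this
  exact LinearPMap.mem_domain_iff.2 ⟨_, this⟩

theorem generator_isClosed (h : IsPowerFamily C T) :
    (generator fun t : ℝ => T (t : ℂ)).IsClosed := by
  obtain ⟨R, hR, hsR⟩ := spectrum.exists_one_le_forall_norm_le C
  rw [LinearPMap.IsClosed, generator_graph]
  have : ((generatorGraph fun t : ℝ => T (t : ℂ)) : Set (E × E)) =
      {p | p.1 = cfc (logResolvent ((Real.log R + 1 : ℝ) : ℂ)) C
        (((Real.log R + 1 : ℝ) : ℂ) • p.1 - p.2)} := by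
    ext ⟨x, y⟩
    exact h.mem_generatorGraph_iff hR hsR (by rw [Complex.ofReal_re]; linarith) x y
  rw [this]
  exact isClosed_eq continuous_fst (by fun_prop)

/-- The graph of the generator is parametrised by `v ↦ (Q v, w Q v - v)`, `Q` the resolvent. Pairing
with `(x, y)` turns the adjoint relation into orthogonality of one fixed vector to all `v`. -/
theorem mem_adjoint_generator_graph_iff (h : IsPowerFamily C T) {R : ℝ} (hR : 1 ≤ R)
    (hsR : ∀ z ∈ spectrum ℂ C, ‖z‖ ≤ R) {w : ℂ} (hw : Real.log R < w.re) (x y : E) :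
    (x, y) ∈ (generator fun t : ℝ => T (t : ℂ)).adjoint.graph ↔
      x = star (cfc (logResolvent w) C) (star w • x - y) := by
  rw [LinearPMap.adjoint_graph_eq_graph_adjoint h.dense_generator_domain,
    Submodule.mem_adjoint_iff, generator_graph]
  have key : ∀ v : E, inner ℂ (w • cfc (logResolvent w) C v - v) x -
      inner ℂ (cfc (logResolvent w) C v) y =
      inner ℂ v (star (cfc (logResolvent w) C) (star w • x - y) - x) := fun v => by
    rw [ContinuousLinearMap.star_eq_adjoint, inner_sub_right v,
      ContinuousLinearMap.adjoint_inner_right, inner_sub_left, inner_smul_left, inner_sub_right,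
      inner_smul_right]
    simp only [Complex.star_def]
    ring
  constructor
  · intro hxy
    -- Testing with that fixed vector itself shows that it vanishes.
    have h1 := hxy _ _ (h.cfc_logResolvent_mem_generatorGraph hR hsR hw
      (star (cfc (logResolvent w) C) (star w • x - y) - x))
    simp only at h1
    rw [key] at h1
    exact (sub_eq_zero.1 (inner_self_eq_zero.1 h1)).symm
  · intro hx a b hab
    rw [h.mem_generatorGraph_iff hR hsR hw] at hab
    have h1 := key (w • a - b)
    rw [← hab, ← hx, sub_self, inner_zero_right, sub_sub_cancel] at h1
    exact h1

/-- If `R` and `S` are resolvents of `A` at `l` and of `B` at `m`, the hypotheses say `y = B x` and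
`z = A y`, and the conclusion says `y' = A x` and `z = B y'`. The factorisation `S = R U` puts the
domain of `B` inside that of `A`, which settles the natural domains of the products. -/
theorem exists_swap_resolvent_graph {E : Type*} [NormedAddCommGroup E] [NormedSpace ℂ E]
    {R S U : E →L[ℂ] E} (hS : S = R * U) (hRU : Commute R U) {l m : ℂ} {x y z : E}
    (h1 : x = S (m • x - y)) (h2 : y = R (l • y - z)) :
    ∃ y', x = R (l • x - y') ∧ y' = S (m • y' - z) := by
  have hR : ∀ v, R (U v) = U (R v) := fun v => congrArg (· v) hRU.eq
  have hS : ∀ v, S v = U (R v) := fun v => by rw [hS, ← hR]; rfl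
  -- With `v = m x - y`, `x = S v = R (U v)`, so `l x - A x` has to be `U v`.
  refine ⟨l • x - U (m • x - y), ?_, ?_⟩
  · rw [sub_sub_cancel, hR, ← hS, ← h1]
  · have h3 : m • (l • x - U (m • x - y)) - z =
        l • (m • x - y) - m • U (m • x - y) + (l • y - z) := by module
    have h4 : ∀ p q, S (l • p - m • U p + q) = l • S p - m • S (U p) + S q := fun p q => by
      simp only [_root_.map_add, map_sub, map_smul]
    rw [h3, h4, hS (l • y - z), ← h2, hS (U _), hR, ← hS, ← h1]
    simp only [map_sub, map_smul]
    abel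

theorem isNormalOperator_generator (h : IsPowerFamily C T) :
    IsNormalOperator (generator fun t : ℝ => T (t : ℂ)) := by
  refine ⟨h.generator_isClosed, h.dense_generator_domain, fun x z => ?_⟩
  obtain ⟨R, hR, hsR⟩ := spectrum.exists_one_le_forall_norm_le C
  set w : ℝ := Real.log R + 1 with hw
  have hwR : Real.log R < w := by linarith
  have hwR' : Real.log R < (w : ℂ).re := by simpa using hwR
  rw [generator_graph]
  simp only [h.mem_adjoint_generator_graph_iff hR hsR hwR', h.mem_generatorGraph_iff hR hsR hwR']
  set Q := cfc (logResolvent w) C with hQ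
  set U := cfc (logPhase w) C with hU
  have h1 : star Q = Q * U := by
    rw [hQ, hU, ← cfc_star, ← cfc_mul _ _ C (continuousOn_logResolvent hwR' h.re_nonneg hsR)
      (continuousOn_logPhase hwR h.re_nonneg hsR)]
    exact cfc_congr fun z hz => (logResolvent_mul_logPhase hwR (hsR z hz)).symm
  have h2 : Commute Q U := cfc_commute_cfc _ _ C
  -- Taking adjoints of `Q* = Q U` gives the factorisation in the other direction, so the swap lemma
  -- serves both inclusions.
  have h3 : Q = star Q * star U := by
    rw [← star_mul, ← h2.eq, ← h1, star_star]
  constructor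
  · rintro ⟨y, hx, hy⟩
    exact exists_swap_resolvent_graph h1 h2 hx hy
  · rintro ⟨y, hx, hy⟩
    exact exists_swap_resolvent_graph h3 h2.star_star hx hy

/-- Any `γ = log R` works, where `R ≥ 1` bounds the spectrum of `C`: beyond it the functional
calculus at `(w - log z)⁻¹` is a bounded two-sided inverse. -/
theorem re_le_of_mem_operatorSpectrum (h : IsPowerFamily C T) :
    ∃ γ : ℝ, ∀ z ∈ operatorSpectrum (generator fun t : ℝ => T (t : ℂ)), z.re ≤ γ := by
  obtain ⟨R, hR, hsR⟩ := spectrum.exists_one_le_forall_norm_le C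
  refine ⟨Real.log R, fun w hw => ?_⟩
  by_contra! hlt
  refine hw ⟨cfc (logResolvent w) C, fun y => ?_, fun x => ?_⟩
  · have h1 := h.cfc_logResolvent_mem_generatorGraph hR hsR hlt y
    rw [← generator_graph, LinearPMap.mem_graph_iff] at h1
    obtain ⟨v, hv1, hv2⟩ := h1
    simp only at hv1 hv2
    refine ⟨hv1 ▸ v.2, ?_⟩
    have : (⟨cfc (logResolvent w) C y, hv1 ▸ v.2⟩ :
        (generator fun t : ℝ => T (t : ℂ)).domain) = v := Subtype.ext hv1.symm
    rw [this, hv2]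
    abel
  · have h1 := LinearPMap.mem_graph (generator fun t : ℝ => T (t : ℂ)) x
    rw [generator_graph, h.mem_generatorGraph_iff hR hsR hlt] at h1
    exact h1.symm

end IsPowerFamily

/-! ### Hausdorff operators: linearity, norm, composition, adjoint -/

theorem quasiMeasurePreserving_mul_right_of_ne_zero {x : ℝ} (hx : x ≠ 0) :
    Measure.QuasiMeasurePreserving (fun u : ℝ => u * x) volume volume := by
  refine ⟨by fun_prop, ?_⟩
  rw [Real.map_volume_mul_right hx]
  exact Measure.smul_absolutelyContinuous

theorem HausdorffKernel.norm {K : ℝ → ℂ} (hK : HausdorffKernel K) :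
    HausdorffKernel fun u => ((‖K u‖ : ℝ) : ℂ) := by
  refine (Integrable.norm hK).ofReal.congr (Eventually.of_forall fun u => ?_)
  simp only [norm_mul, Complex.norm_real]
  rw [Real.norm_of_nonneg (by positivity : (0 : ℝ) ≤ |u| ^ (-(1 / 2) : ℝ))]
  exact Complex.ofReal_mul _ _

theorem HausdorffKernel.add {K L : ℝ → ℂ} (hK : HausdorffKernel K) (hL : HausdorffKernel L) :
    HausdorffKernel fun u => K u + L u :=
  (Integrable.add hK hL).congr (Eventually.of_forall fun u => by simp [add_mul])

theorem HausdorffKernel.const_mul {K : ℝ → ℂ} (hK : HausdorffKernel K) (c : ℂ) :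
    HausdorffKernel fun u => c * K u :=
  (Integrable.const_mul hK c).congr (Eventually.of_forall fun u => by simp [mul_assoc])

theorem HausdorffKernel.sub {K L : ℝ → ℂ} (hK : HausdorffKernel K) (hL : HausdorffKernel L) :
    HausdorffKernel fun u => K u - L u :=
  (Integrable.sub hK hL).congr (Eventually.of_forall fun u => by simp [sub_mul])

theorem hausdorffOp_add {K L : ℝ → ℂ} (hK : HausdorffKernel K) (hL : HausdorffKernel L) :
    hausdorffOp (fun u => K u + L u) (hK.add hL) = hausdorffOp K hK + hausdorffOp L hL := by
  ext1 f
  refine Lp.ext ?_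
  rw [add_apply]
  filter_upwards [Lp.coeFn_add (hausdorffOp K hK f) (hausdorffOp L hL f),
    hausdorffOp_apply_ae _ hK f, hausdorffOp_apply_ae _ hL f,
    hausdorffOp_apply_ae _ (hK.add hL) f, hausdorff_integrable hK f, hausdorff_integrable hL f]
    with x h1 h2 h3 h4 h5 h6
  rw [h1, Pi.add_apply, h2, h3, h4, ← integral_add h5 h6]
  simp only [add_mul]

theorem hausdorffOp_const_mul {K : ℝ → ℂ} (hK : HausdorffKernel K) (c : ℂ) :
    hausdorffOp (fun u => c * K u) (hK.const_mul c) = c • hausdorffOp K hK := by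
  ext1 f
  refine Lp.ext ?_
  rw [smul_apply]
  filter_upwards [Lp.coeFn_smul c (hausdorffOp K hK f),
    hausdorffOp_apply_ae _ hK f, hausdorffOp_apply_ae _ (hK.const_mul c) f] with x h1 h2 h3
  rw [h1, Pi.smul_apply, h2, h3, smul_eq_mul, ← integral_const_mul]
  simp only [mul_assoc]

theorem hausdorffOp_congr {K L : ℝ → ℂ} (hK : HausdorffKernel K) (hL : HausdorffKernel L)
    (h : K =ᵐ[volume] L) : hausdorffOp K hK = hausdorffOp L hL := by
  ext1 f
  refine Lp.ext ?_
  filter_upwards [hausdorffOp_apply_ae _ hK f, hausdorffOp_apply_ae _ hL f] with x h1 h2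
  rw [h1, h2]
  refine integral_congr_ae ?_
  filter_upwards [h] with u hu
  rw [hu]

theorem hausdorffOp_sub {K L : ℝ → ℂ} (hK : HausdorffKernel K) (hL : HausdorffKernel L) :
    hausdorffOp (fun u => K u - L u) (hK.sub hL) = hausdorffOp K hK - hausdorffOp L hL := by
  rw [eq_sub_iff_add_eq, ← hausdorffOp_add]
  exact hausdorffOp_congr _ _ (Eventually.of_forall fun u => by simp)

theorem norm_hausdorffOp_le {K : ℝ → ℂ} (hK : HausdorffKernel K) :
    ‖hausdorffOp K hK‖ ≤ ∫ u, ‖K u‖ * |u| ^ (-(1 / 2) : ℝ) := by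
  have h1 : ‖hausdorffOp K hK‖ ≤
      (∫⁻ u, ‖K u * ((|u| ^ (-(1 / 2) : ℝ) : ℝ) : ℂ)‖ₑ).toReal :=
    LinearMap.mkContinuous_norm_le _ ENNReal.toReal_nonneg _
  refine h1.trans_eq ?_
  rw [← integral_norm_eq_lintegral_enorm hK.1]
  refine integral_congr_ae (Eventually.of_forall fun u => ?_)
  simp only [norm_mul, Complex.norm_real]
  rw [Real.norm_of_nonneg (by positivity : (0 : ℝ) ≤ |u| ^ (-(1 / 2) : ℝ))]

/-- This function is the operator with kernel `|K|` applied to `|f|`. It supplies the absolute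
convergence needed for Fubini in the composition and adjoint formulas. -/
theorem memLp_integral_norm_mul {K : ℝ → ℂ} (hK : HausdorffKernel K) (f : L2R) :
    MemLp (fun x : ℝ => ∫ u, ‖K u * f (u * x)‖) 2 volume := by
  have hf : MemLp (fun x => ((‖f x‖ : ℝ) : ℂ)) 2 volume := (Lp.memLp f).norm.ofReal
  refine MemLp.ae_eq ?_ (hausdorffFun_memLp hK.norm (hf.toLp _)).norm
  filter_upwards [hausdorffFun_congr (fun u => ((‖K u‖ : ℝ) : ℂ)) hf.coeFn_toLp] with x hx
  rw [hx, hausdorffFun]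
  have : ∀ u : ℝ, ((‖K u‖ : ℝ) : ℂ) * ((‖f (u * x)‖ : ℝ) : ℂ) =
      ((‖K u * f (u * x)‖ : ℝ) : ℂ) := fun u => by rw [norm_mul, Complex.ofReal_mul]
  simp only [this]
  rw [integral_complex_ofReal, Complex.norm_real, Real.norm_of_nonneg]
  exact integral_nonneg fun u => norm_nonneg _

theorem integral_comp_div_mul_inv_abs {F : Type*} [NormedAddCommGroup F] [NormedSpace ℝ F]
    (φ : ℝ → F) {x : ℝ} (hx : x ≠ 0) : ∫ t, |x|⁻¹ • φ (t / x) = ∫ u, φ u := by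
  rw [integral_smul, Measure.integral_comp_div, smul_smul, inv_mul_cancel₀ (abs_ne_zero.2 hx),
    one_smul]

/-- Composition of Hausdorff operators is multiplicative convolution of their kernels. -/
theorem hausdorffOp_mul_eq {K L M : ℝ → ℂ} (hK : HausdorffKernel K) (hL : HausdorffKernel L)
    (hM : HausdorffKernel M) (hKm : Measurable K) (hLm : Measurable L)
    (h : ∀ᵐ w : ℝ, M w = ∫ u, K u * (L (w / u) * ((|u|⁻¹ : ℝ) : ℂ))) :
    hausdorffOp K hK * hausdorffOp L hL = hausdorffOp M hM := by
  ext1 f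
  refine Lp.ext ?_
  have hfm : Measurable f := (Lp.stronglyMeasurable f).measurable
  have hg := (memLp_integral_norm_mul hL f).ofReal (K := ℂ)
  filter_upwards [hausdorffOp_apply_ae K hK (hausdorffOp L hL f), hausdorffOp_apply_ae M hM f,
    hausdorffFun_congr K (hausdorffOp_apply_ae L hL f), ae_ne_zero_real,
    hausdorff_integrable hK (hg.toLp _)] with x h1 h2 h3 hx h5
  rw [mul_apply_eq_comp, h1, h2]
  refine h3.trans ?_
  simp only [hausdorffFun]
  have hq := quasiMeasurePreserving_mul_right_of_ne_zero hx
  set Φ : ℝ → ℝ → ℂ := fun u w => K u * (L (w / u) * ((|u|⁻¹ : ℝ) : ℂ)) * f (w * x) with hΦ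
  have hΦu : ∀ u : ℝ, u ≠ 0 → ∀ w,
      Φ u w = |u|⁻¹ • (fun v => K u * (L v * f (v * (u * x)))) (w / u) := fun u hu w => by
    have : w / u * (u * x) = w * x := by field_simp
    simp only [hΦ, this, Complex.real_smul]
    ring
  have e1 : ∀ᵐ u : ℝ, K u * ∫ v, L v * f (v * (u * x)) = ∫ w, Φ u w := by
    filter_upwards [ae_ne_zero_real] with u hu
    rw [← integral_const_mul, ← integral_comp_div_mul_inv_abs _ hu]
    exact integral_congr_ae (Eventually.of_forall fun w => (hΦu u hu w).symm)
  -- The inner integral of `|Φ|` is `|K u|` times the `L²` function `g` at `u x`, so applying the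
  -- integrability lemma for `K` to `g` bounds the double integral for almost every `x`.
  have e2 : Integrable (Function.uncurry Φ) (volume.prod volume) := by
    rw [integrable_prod_iff]
    · constructor
      · filter_upwards [ae_ne_zero_real, hq.ae (hausdorff_integrable hL f)] with u hu h6
        have h7 : Integrable fun w => |u|⁻¹ • (fun v => K u * (L v * f (v * (u * x)))) (w / u) :=
          ((h6.const_mul (K u)).comp_div hu).smul |u|⁻¹
        exact h7.congr (Eventually.of_forall fun w => (hΦu u hu w).symm)
      · refine h5.norm.congr ?_
        filter_upwards [ae_ne_zero_real, hq.ae hg.coeFn_toLp] with u hu h6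
        have h7 : ∀ w, ‖Function.uncurry Φ (u, w)‖ =
            |u|⁻¹ • (fun v => ‖K u‖ * ‖L v * f (v * (u * x))‖) (w / u) := fun w => by
          simp only [Function.uncurry_apply_pair]
          rw [hΦu u hu w, norm_smul, norm_inv, Real.norm_eq_abs, abs_abs, norm_mul (K u)]
          rfl
        simp only [h7]
        rw [integral_comp_div_mul_inv_abs (fun v => ‖K u‖ * ‖L v * f (v * (u * x))‖) hu, h6,
          norm_mul, integral_const_mul]
        congr 1
        refine (Complex.norm_real _).trans (Real.norm_of_nonneg ?_)
        exact integral_nonneg fun u => norm_nonneg _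
    · apply Measurable.aestronglyMeasurable
      simp only [hΦ, Function.uncurry_def]
      fun_prop
  rw [integral_congr_ae e1, integral_integral_swap e2]
  refine integral_congr_ae ?_
  filter_upwards [h] with w hw
  simp only [hΦ]
  rw [integral_mul_const, hw]

/-- The adjoint of the Hausdorff operator with kernel `K` has kernel `conj (K (1 / v)) / |v|`. -/
theorem star_hausdorffOp {K L : ℝ → ℂ} (hK : HausdorffKernel K) (hL : HausdorffKernel L)
    (hKm : Measurable K) (h : ∀ v : ℝ, v ≠ 0 → L v = star (K v⁻¹) * ((|v|⁻¹ : ℝ) : ℂ)) :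
    star (hausdorffOp K hK) = hausdorffOp L hL := by
  symm
  rw [ContinuousLinearMap.star_eq_adjoint, ContinuousLinearMap.eq_adjoint_iff]
  intro g f
  have hfm : Measurable f := (Lp.stronglyMeasurable f).measurable
  have hgm : Measurable g := (Lp.stronglyMeasurable g).measurable
  rw [L2.inner_def, L2.inner_def]
  simp only [RCLike.inner_apply, starRingEnd_apply]
  set Φ : ℝ → ℝ → ℂ := fun x t => star (g x) * (K (t / x) * ((|x|⁻¹ : ℝ) : ℂ) * f t) with hΦ
  have hΦx : ∀ x : ℝ, x ≠ 0 → ∀ t,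
      Φ x t = |x|⁻¹ • (fun u => star (g x) * (K u * f (u * x))) (t / x) := fun x hx t => by
    have : t / x * x = t := by field_simp
    simp only [hΦ, this, Complex.real_smul]
    ring
  have e1 : ∀ᵐ x : ℝ, hausdorffOp K hK f x * star (g x) = ∫ t, Φ x t := by
    filter_upwards [ae_ne_zero_real, hausdorffOp_apply_ae K hK f] with x hx h1
    rw [h1, mul_comm, ← integral_const_mul, ← integral_comp_div_mul_inv_abs _ hx]
    exact integral_congr_ae (Eventually.of_forall fun t => (hΦx x hx t).symm)
  have e2 : ∀ᵐ t : ℝ, f t * star (hausdorffOp L hL g t) = ∫ x, Φ x t := by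
    filter_upwards [ae_ne_zero_real, hausdorffOp_apply_ae L hL g] with t ht h1
    have h2 : star (∫ u, L u * g (u * t)) = ∫ u, star (L u * g (u * t)) :=
      (integral_conj (f := fun u => L u * g (u * t))).symm
    rw [h1, h2, ← integral_const_mul, ← integral_comp_div_mul_inv_abs _ ht]
    refine integral_congr_ae ?_
    filter_upwards [ae_ne_zero_real] with x hx
    have h3 : x / t * t = x := by field_simp
    have h4 : |t|⁻¹ * |x / t|⁻¹ = |x|⁻¹ := by
      have := abs_ne_zero.2 ht
      have := abs_ne_zero.2 hx
      rw [abs_div]; field_simp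
    simp only [hΦ, h3, h _ (div_ne_zero hx ht), inv_div, star_mul, Complex.real_smul,
      Complex.star_def, Complex.conj_ofReal, Complex.conj_conj]
    rw [← h4, Complex.ofReal_mul]
    ring
  have e3 : Integrable (Function.uncurry Φ) (volume.prod volume) := by
    rw [integrable_prod_iff]
    · constructor
      · filter_upwards [ae_ne_zero_real, hausdorff_integrable hK f] with x hx h6
        have h7 : Integrable fun t => |x|⁻¹ • (fun u => star (g x) * (K u * f (u * x))) (t / x) :=
          ((h6.const_mul (star (g x))).comp_div hx).smul |x|⁻¹
        exact h7.congr (Eventually.of_forall fun t => (hΦx x hx t).symm)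
      -- A product of two `L²` functions is integrable.
      · have h8 : Integrable fun x => ‖g x‖ * ∫ u, ‖K u * f (u * x)‖ :=
          (Lp.memLp g).norm.integrable_mul (memLp_integral_norm_mul hK f)
        refine h8.congr ?_
        filter_upwards [ae_ne_zero_real] with x hx
        have h7 : ∀ t, ‖Function.uncurry Φ (x, t)‖ =
            |x|⁻¹ • (fun u => ‖g x‖ * ‖K u * f (u * x)‖) (t / x) := fun t => by
          simp only [Function.uncurry_apply_pair]
          rw [hΦx x hx t, norm_smul, norm_inv, Real.norm_eq_abs, abs_abs, norm_mul (star (g x)),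
            norm_star]
          rfl
        simp only [h7]
        rw [integral_comp_div_mul_inv_abs (fun u => ‖g x‖ * ‖K u * f (u * x)‖) hx,
          integral_const_mul]
    · apply Measurable.aestronglyMeasurable
      simp only [hΦ, Function.uncurry_def]
      fun_prop
  rw [integral_congr_ae e1, integral_congr_ae e2]
  exact (integral_integral_swap e3).symm

/-! ### The Cesàro operator: normality, spectrum, dense range -/

theorem hausdorffKernel_indicator_of_continuous {p : ℝ → ℂ} (hp : Continuous p) :
    HausdorffKernel ((Set.Ioo (0 : ℝ) 1).indicator p) := by
  obtain ⟨B, hB⟩ := isCompact_Icc.exists_bound_of_continuousOn (s := Set.Icc (0 : ℝ) 1) hp.continuousOn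
  refine Integrable.mono' (g := fun u : ℝ => B * ‖cesaroKernel u * ((|u| ^ (-(1 / 2) : ℝ) : ℝ) : ℂ)‖)
    (Integrable.norm hausdorffKernel_cesaroKernel |>.const_mul B) ?_ ?_
  · exact ((hp.measurable.indicator measurableSet_Ioo).mul (by fun_prop)).aestronglyMeasurable
  · refine Eventually.of_forall fun u => ?_
    by_cases hu : u ∈ Set.Ioo (0 : ℝ) 1
    · rw [cesaroKernel, Set.indicator_of_mem hu, Set.indicator_of_mem hu, one_mul, norm_mul]
      exact mul_le_mul_of_nonneg_right (hB u ⟨hu.1.le, hu.2.le⟩) (norm_nonneg _)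
    · rw [cesaroKernel, Set.indicator_of_notMem hu, Set.indicator_of_notMem hu]
      simp

theorem measurable_cesaroKernel : Measurable cesaroKernel :=
  measurable_const.indicator measurableSet_Ioo

/-- The kernel `χ_{(1,∞)}(v) / v` of the adjoint of the Cesàro operator. -/
noncomputable def cesaroDualKernel : ℝ → ℂ := (Set.Ioi (1 : ℝ)).indicator fun v => ((v⁻¹ : ℝ) : ℂ)

theorem measurable_cesaroDualKernel : Measurable cesaroDualKernel :=
  Measurable.indicator (by fun_prop) measurableSet_Ioi

theorem hausdorffKernel_cesaroDualKernel : HausdorffKernel cesaroDualKernel := by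
  have h1 : IntegrableOn (fun v : ℝ => ((v ^ (-(3 / 2) : ℝ) : ℝ) : ℂ)) (Set.Ioi 1) :=
    (integrableOn_Ioi_rpow_of_lt (by norm_num) one_pos).ofReal
  refine ((integrable_indicator_iff measurableSet_Ioi).2 h1).congr (Eventually.of_forall fun v => ?_)
  by_cases hv : v ∈ Set.Ioi (1 : ℝ)
  · have hv0 : 0 < v := one_pos.trans hv
    simp only [cesaroDualKernel, Set.indicator_of_mem hv]
    rw [← Complex.ofReal_mul, abs_of_pos hv0, ← Real.rpow_neg_one v, ← Real.rpow_add hv0]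
    norm_num
  · simp [cesaroDualKernel, Set.indicator_of_notMem hv]

theorem star_cesaroOp :
    star cesaroOp = hausdorffOp cesaroDualKernel hausdorffKernel_cesaroDualKernel := by
  refine star_hausdorffOp _ _ measurable_cesaroKernel fun v hv => ?_
  have key : v⁻¹ ∈ Set.Ioo (0 : ℝ) 1 ↔ v ∈ Set.Ioi 1 := by
    constructor
    · rintro ⟨h0, h1⟩
      exact (inv_lt_one₀ (inv_pos.1 h0)).1 h1
    · intro h
      have h0 : 0 < v := one_pos.trans h
      exact ⟨inv_pos.2 h0, (inv_lt_one₀ h0).2 h⟩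
  by_cases h : v ∈ Set.Ioi (1 : ℝ)
  · have h0 : 0 < v := one_pos.trans h
    rw [cesaroDualKernel, cesaroKernel, Set.indicator_of_mem h, Set.indicator_of_mem (key.2 h),
      abs_of_pos h0, star_one, one_mul]
  · rw [cesaroDualKernel, cesaroKernel, Set.indicator_of_notMem h,
      Set.indicator_of_notMem (mt key.1 h), star_zero, zero_mul]

theorem cesaroKernel_add_dual_eq {w : ℝ} (hw0 : w ≠ 0) (hw1 : w ≠ 1) :
    cesaroKernel w + cesaroDualKernel w =
      if 0 < w then (((max 1 w)⁻¹ : ℝ) : ℂ) else 0 := by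
  rcases lt_or_gt_of_ne hw0 with h | h
  · rw [cesaroKernel, cesaroDualKernel, Set.indicator_of_notMem (fun h' => h.not_gt h'.1),
      Set.indicator_of_notMem (by simp; linarith), if_neg h.not_gt, add_zero]
  rw [if_pos h, cesaroKernel, cesaroDualKernel]
  rcases lt_or_gt_of_ne hw1 with h' | h'
  · rw [Set.indicator_of_mem (show w ∈ Set.Ioo (0 : ℝ) 1 from ⟨h, h'⟩),
      Set.indicator_of_notMem (by simpa using h'.le), max_eq_left h'.le]
    simp
  · rw [Set.indicator_of_notMem (fun h1 => h'.not_gt h1.2),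
      Set.indicator_of_mem (show w ∈ Set.Ioi 1 from h'), max_eq_right h'.le, zero_add]

theorem integral_cesaroKernel_mul_dual {w : ℝ} :
    ∫ u, cesaroKernel u * (cesaroDualKernel (w / u) * ((|u|⁻¹ : ℝ) : ℂ)) =
      if 0 < w then (((max 1 w)⁻¹ : ℝ) : ℂ) else 0 := by
  have e : ∀ u, cesaroKernel u * (cesaroDualKernel (w / u) * ((|u|⁻¹ : ℝ) : ℂ)) =
      (Set.Ioo (0 : ℝ) (min 1 w)).indicator (fun _ => ((w⁻¹ : ℝ) : ℂ)) u := fun u => by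
    by_cases hu : u ∈ Set.Ioo (0 : ℝ) 1
    · rw [cesaroKernel, cesaroDualKernel, Set.indicator_of_mem hu, one_mul]
      by_cases huw : u < w
      · have h1 : w / u ∈ Set.Ioi (1 : ℝ) := (one_lt_div hu.1).2 huw
        have hw : w ≠ 0 := (hu.1.trans huw).ne'
        have hu0 := hu.1.ne'
        rw [Set.indicator_of_mem h1, Set.indicator_of_mem
          (show u ∈ Set.Ioo 0 (min 1 w) from ⟨hu.1, lt_min hu.2 huw⟩),
          abs_of_pos hu.1, ← Complex.ofReal_mul]
        congr 1
        field_simp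
      · have h1 : w / u ∉ Set.Ioi (1 : ℝ) := fun h => huw ((one_lt_div hu.1).1 h)
        rw [Set.indicator_of_notMem h1, Set.indicator_of_notMem
          (show u ∉ Set.Ioo 0 (min 1 w) from fun h => huw (h.2.trans_le (min_le_right _ _))), zero_mul]
    · rw [cesaroKernel, Set.indicator_of_notMem hu, Set.indicator_of_notMem
        (show u ∉ Set.Ioo 0 (min 1 w) from fun h => hu ⟨h.1, h.2.trans_le (min_le_left _ _)⟩), zero_mul]
  simp only [e]
  rw [integral_indicator measurableSet_Ioo, setIntegral_const]
  split_ifs with h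
  · have h1 : (0 : ℝ) ≤ min 1 w := le_min zero_le_one h.le
    rw [Real.volume_real_Ioo_of_le h1, sub_zero, Complex.real_smul, ← Complex.ofReal_mul]
    congr 1
    rcases le_total 1 w with h2 | h2
    · rw [min_eq_left h2, max_eq_right h2, one_mul]
    · rw [min_eq_right h2, max_eq_left h2, mul_inv_cancel₀ h.ne', inv_one]
  · rw [Set.Ioo_eq_empty (fun h1 => h (h1.trans_le (min_le_right _ _)))]
    simp

theorem integral_dual_mul_cesaroKernel {w : ℝ} :
    ∫ u, cesaroDualKernel u * (cesaroKernel (w / u) * ((|u|⁻¹ : ℝ) : ℂ)) =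
      if 0 < w then (((max 1 w)⁻¹ : ℝ) : ℂ) else 0 := by
  split_ifs with h
  · have e : ∀ u, cesaroDualKernel u * (cesaroKernel (w / u) * ((|u|⁻¹ : ℝ) : ℂ)) =
        (Set.Ioi (max 1 w)).indicator (fun u => ((u ^ (-2 : ℝ) : ℝ) : ℂ)) u := fun u => by
      by_cases hu : u ∈ Set.Ioi (1 : ℝ)
      · have hu0 : 0 < u := one_pos.trans hu
        rw [cesaroDualKernel, cesaroKernel, Set.indicator_of_mem hu]
        by_cases huw : w < u
        · have h1 : w / u ∈ Set.Ioo (0 : ℝ) 1 := ⟨div_pos h hu0, (div_lt_one hu0).2 huw⟩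
          rw [Set.indicator_of_mem h1, Set.indicator_of_mem (show u ∈ Set.Ioi (max 1 w) from max_lt hu huw),
            abs_of_pos hu0, one_mul, ← Complex.ofReal_mul, Real.rpow_neg hu0.le, ← mul_inv]
          norm_cast
          rw [sq]
        · have h1 : w / u ∉ Set.Ioo (0 : ℝ) 1 := fun h' => huw ((div_lt_one hu0).1 h'.2)
          rw [Set.indicator_of_notMem h1, Set.indicator_of_notMem
            (show u ∉ Set.Ioi (max 1 w) from
              fun h' => huw ((le_max_right _ _).trans_lt (Set.mem_Ioi.1 h'))), zero_mul, mul_zero]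
      · rw [cesaroDualKernel, Set.indicator_of_notMem hu, Set.indicator_of_notMem
          (show u ∉ Set.Ioi (max 1 w) from
            fun h' => hu (Set.mem_Ioi.2 ((le_max_left _ _).trans_lt (Set.mem_Ioi.1 h')))), zero_mul]
    simp only [e]
    have h0 : 0 < max 1 w := lt_max_of_lt_left one_pos
    rw [integral_indicator measurableSet_Ioi, integral_complex_ofReal,
      integral_Ioi_rpow_of_lt (by norm_num) h0]
    congr 1
    norm_num
    rw [Real.rpow_neg_one]
  · rw [← integral_zero (α := ℝ) (G := ℂ) (μ := volume)]
    refine integral_congr_ae (Eventually.of_forall fun u => ?_)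
    by_cases hu : u ∈ Set.Ioi (1 : ℝ)
    · have hu0 : 0 < u := one_pos.trans hu
      have h1 : w / u ∉ Set.Ioo (0 : ℝ) 1 := fun h' => h (by
        have := mul_pos h'.1 hu0
        rwa [div_mul_cancel₀ _ hu0.ne'] at this)
      simp only [cesaroKernel, Set.indicator_of_notMem h1, zero_mul, mul_zero]
    · simp only [cesaroDualKernel, Set.indicator_of_notMem hu, zero_mul]

theorem ae_ne_real (a : ℝ) : ∀ᵐ u : ℝ, u ≠ a := by
  simp [ae_iff]

theorem cesaroOp_mul_star : cesaroOp * star cesaroOp = cesaroOp + star cesaroOp := by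
  rw [star_cesaroOp, cesaroOp, ← hausdorffOp_add]
  refine hausdorffOp_mul_eq _ _ _ measurable_cesaroKernel measurable_cesaroDualKernel ?_
  filter_upwards [ae_ne_real 0, ae_ne_real 1] with w h0 h1
  rw [cesaroKernel_add_dual_eq h0 h1, integral_cesaroKernel_mul_dual]

theorem star_mul_cesaroOp : star cesaroOp * cesaroOp = cesaroOp + star cesaroOp := by
  rw [star_cesaroOp, cesaroOp, ← hausdorffOp_add]
  refine hausdorffOp_mul_eq _ _ _ measurable_cesaroDualKernel measurable_cesaroKernel ?_
  filter_upwards [ae_ne_real 0, ae_ne_real 1] with w h0 h1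
  rw [cesaroKernel_add_dual_eq h0 h1, integral_dual_mul_cesaroKernel]

theorem isStarNormal_cesaroOp : IsStarNormal cesaroOp :=
  ⟨star_mul_cesaroOp.trans cesaroOp_mul_star.symm⟩

/-- Expanding `(1 - C)(1 - C*)` in either order, the product term cancels `C + C*`. -/
theorem one_sub_cesaroOp_mem_unitary : 1 - cesaroOp ∈ unitary (L2R →L[ℂ] L2R) := by
  rw [Unitary.mem_iff]
  simp only [star_sub, star_one, sub_mul, mul_sub, one_mul, mul_one, star_mul_cesaroOp,
    cesaroOp_mul_star]
  constructor <;> abel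

theorem norm_one_sub_of_mem_spectrum_cesaroOp {z : ℂ} (hz : z ∈ spectrum ℂ cesaroOp) :
    ‖1 - z‖ = 1 := by
  have h1 : 1 - z ∈ spectrum ℂ (1 - cesaroOp) := by
    rw [← map_one (algebraMap ℂ (L2R →L[ℂ] L2R)), ← spectrum.singleton_sub_eq]
    exact Set.sub_mem_sub rfl hz
  simpa using spectrum.subset_circle_of_unitary one_sub_cesaroOp_mem_unitary h1

theorem re_nonneg_of_mem_spectrum_cesaroOp {z : ℂ} (hz : z ∈ spectrum ℂ cesaroOp) : 0 ≤ z.re := by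
  have h1 := Complex.re_le_norm (1 - z)
  rw [norm_one_sub_of_mem_spectrum_cesaroOp hz] at h1
  simp at h1
  exact h1

/-- Inversion maps the circle `|1 - z| = 1`, which passes through `0`, to the line `Re s = 1/2`. On
this line `|u^(s - 1)|` is exactly the weight `u^(-1/2)` of the kernel condition. -/
theorem re_inv_of_mem_spectrum_cesaroOp {z : ℂ} (hz : z ∈ spectrum ℂ cesaroOp) (hz0 : z ≠ 0) :
    (z⁻¹).re = 1 / 2 := by
  have h1 : Complex.normSq (1 - z) = 1 := by
    rw [Complex.normSq_eq_norm_sq, norm_one_sub_of_mem_spectrum_cesaroOp hz, one_pow]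
  have h2 : Complex.normSq z ≠ 0 := Complex.normSq_eq_zero.not.2 hz0
  rw [Complex.inv_re, div_eq_div_iff h2 (by norm_num)]
  simp only [Complex.normSq_apply, Complex.sub_re, Complex.sub_im, Complex.one_re,
    Complex.one_im] at h1 ⊢
  linarith

theorem cesaroOp_injective : Function.Injective cesaroOp := by
  rw [injective_iff_map_eq_zero]
  intro f hf
  have hloc : LocallyIntegrable f volume := (Lp.memLp f).locallyIntegrable (by norm_num)
  have h1 : ∀ᵐ x : ℝ, ∫ t in (0 : ℝ)..x, f t = 0 := by
    have h2 := cesaroOp_apply_ae f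
    rw [hf] at h2
    filter_upwards [h2, Lp.coeFn_zero ℂ 2 (volume : Measure ℝ), ae_ne_zero_real] with x h3 h4 hx
    rw [h4] at h3
    have h5 : ((1 / x : ℝ) : ℂ) ≠ 0 := by simpa using hx
    exact (mul_eq_zero.1 h3.symm).resolve_left h5
  -- The primitive is continuous, so vanishing almost everywhere means vanishing everywhere; its
  -- derivative recovers `f` almost everywhere.
  have h2 : (fun x => ∫ t in (0 : ℝ)..x, f t) = fun _ => 0 :=
    Continuous.ae_eq_iff_eq volume
      (intervalIntegral.continuous_primitive (fun a b => ((LocallyIntegrable.integrableOn_isCompact hloc isCompact_uIcc).intervalIntegrable)) 0)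
      continuous_const |>.1 h1
  refine Lp.ext ?_
  filter_upwards [LocallyIntegrable.ae_hasDerivAt_integral hloc, Lp.coeFn_zero ℂ 2 (volume : Measure ℝ)] with x h3 h4
  have h5 := h3 0
  rw [h2] at h5
  rw [h4]
  exact h5.unique (hasDerivAt_const x 0)

theorem denseRange_cesaroOp : DenseRange cesaroOp := by
  -- The orthogonal complement of the range is `ker C*`, equal to `ker C` by normality.
  have h1 : (cesaroOp.range)ᗮ = ⊥ := by
    rw [ContinuousLinearMap.orthogonal_range, LinearMap.ker_eq_bot']
    intro f hf
    refine cesaroOp_injective ?_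
    rw [map_zero, ← norm_eq_zero]
    have := (ContinuousLinearMap.isStarNormal_iff_norm_eq_adjoint.1 isStarNormal_cesaroOp) f
    rw [this]
    exact norm_eq_zero.2 hf
  have h2 := Submodule.dense_iff_topologicalClosure_eq_top.2
    (Submodule.topologicalClosure_eq_top_iff.2 h1)
  exact h2

/-- For `0 < w < 1` the convolved kernel is `∫_w^1 u^n du = (1 - w^(n+1)) / (n + 1)`. Rearranged,
the operator `H` with kernel `u^(n+1)` satisfies `H (1 + (n + 1) C) = C`, which expresses it as a
function of `C`. -/
theorem hausdorffOp_pow_mul_cesaroOp (n : ℕ) :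
    hausdorffOp _ (hausdorffKernel_indicator_of_continuous
      (p := fun u : ℝ => (u : ℂ) ^ (n + 1)) (by fun_prop)) * cesaroOp =
    ((n + 1 : ℂ)⁻¹) • (cesaroOp - hausdorffOp _ (hausdorffKernel_indicator_of_continuous
      (p := fun u : ℝ => (u : ℂ) ^ (n + 1)) (by fun_prop))) := by
  rw [cesaroOp, ← hausdorffOp_sub, ← hausdorffOp_const_mul]
  refine hausdorffOp_mul_eq _ _ _ (Measurable.indicator (by fun_prop) measurableSet_Ioo)
    measurable_cesaroKernel (Eventually.of_forall fun w => ?_)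
  by_cases hw : w ∈ Set.Ioo (0 : ℝ) 1
  · have e : ∀ u, (Set.Ioo (0 : ℝ) 1).indicator (fun u : ℝ => (u : ℂ) ^ (n + 1)) u *
        (cesaroKernel (w / u) * ((|u|⁻¹ : ℝ) : ℂ)) =
        (Set.Ioo w 1).indicator (fun u => ((u ^ n : ℝ) : ℂ)) u := fun u => by
      by_cases hu : u ∈ Set.Ioo (0 : ℝ) 1
      · rw [cesaroKernel, Set.indicator_of_mem hu]
        by_cases huw : w < u
        · have h1 : w / u ∈ Set.Ioo (0 : ℝ) 1 := ⟨div_pos hw.1 hu.1, (div_lt_one hu.1).2 huw⟩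
          have hu0 : (u : ℂ) ≠ 0 := Complex.ofReal_ne_zero.2 hu.1.ne'
          rw [Set.indicator_of_mem h1, Set.indicator_of_mem (show u ∈ Set.Ioo w 1 from ⟨huw, hu.2⟩), abs_of_pos hu.1, one_mul]
          push_cast
          field_simp
          ring
        · have h1 : w / u ∉ Set.Ioo (0 : ℝ) 1 := fun h' => huw ((div_lt_one hu.1).1 h'.2)
          rw [Set.indicator_of_notMem h1, Set.indicator_of_notMem (show u ∉ Set.Ioo w 1 from fun h' => huw h'.1), zero_mul,
            mul_zero]
      · rw [Set.indicator_of_notMem hu, Set.indicator_of_notMem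
          (show u ∉ Set.Ioo w 1 from fun h' => hu ⟨hw.1.trans h'.1, h'.2⟩), zero_mul]
    simp only [e]
    rw [integral_indicator measurableSet_Ioo, integral_complex_ofReal, ← integral_Ioc_eq_integral_Ioo,
      ← intervalIntegral.integral_of_le hw.2.le, integral_pow, cesaroKernel,
      Set.indicator_of_mem hw, Set.indicator_of_mem hw]
    push_cast
    rw [one_pow, div_eq_inv_mul]
  · rw [cesaroKernel, Set.indicator_of_notMem hw, Set.indicator_of_notMem hw, sub_zero, mul_zero,
      ← integral_zero (α := ℝ) (G := ℂ) (μ := volume)]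
    refine integral_congr_ae (Eventually.of_forall fun u => ?_)
    by_cases hu : u ∈ Set.Ioo (0 : ℝ) 1
    · have h1 : w / u ∉ Set.Ioo (0 : ℝ) 1 := fun h' => hw (by
        have h2 := mul_pos h'.1 hu.1
        rw [div_mul_cancel₀ _ hu.1.ne'] at h2
        exact ⟨h2, ((div_lt_one hu.1).1 h'.2).trans hu.2⟩)
      simp only [Set.indicator_of_notMem h1, zero_mul, mul_zero]
    · simp only [Set.indicator_of_notMem hu, zero_mul]

/-! ### Euler's integral with a complex scale -/

theorem integrableOn_cpow_mul_exp_neg_mul {a r : ℂ} (ha : 0 < a.re) (hr : 0 < r.re) :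
    IntegrableOn (fun t : ℝ => (t : ℂ) ^ (a - 1) * Complex.exp (-(r * t))) (Set.Ioi 0) := by
  have h := integrableOn_rpow_mul_exp_neg_mul_rpow (s := a.re - 1) (p := 1) (b := r.re)
    (by linarith) one_pos hr
  refine Integrable.mono' h ?_ ?_
  · exact Measurable.aestronglyMeasurable (by fun_prop)
  · filter_upwards [ae_restrict_mem measurableSet_Ioi] with t ht
    have ht : 0 < t := ht
    rw [norm_mul, Complex.norm_cpow_eq_rpow_re_of_pos ht, Complex.norm_exp]
    simp

theorem hasDerivAt_integral_cpow_mul_exp_neg_mul {a r : ℂ} (ha : 0 < a.re) (hr : 0 < r.re) :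
    HasDerivAt (fun r : ℂ => ∫ t in Set.Ioi (0 : ℝ), (t : ℂ) ^ (a - 1) * Complex.exp (-(r * t)))
      (∫ t in Set.Ioi (0 : ℝ), (t : ℂ) ^ (a - 1) * (Complex.exp (-(r * t)) * (-t))) r := by
  refine (hasDerivAt_integral_of_dominated_loc_of_deriv_le
    (F := fun (r : ℂ) (t : ℝ) => (t : ℂ) ^ (a - 1) * Complex.exp (-(r * t)))
    (F' := fun (r : ℂ) (t : ℝ) => (t : ℂ) ^ (a - 1) * (Complex.exp (-(r * t)) * (-t)))
    (bound := fun t : ℝ => t ^ a.re * Real.exp (-(r.re / 2) * t ^ (1 : ℝ)))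
    (s := {w : ℂ | r.re / 2 < w.re}) ?_ ?_ ?_ ?_ ?_ ?_ ?_).2
  -- On the half-plane `Re w > Re r / 2` the derivative has a dominating function independent of
  -- `w`.
  · exact (isOpen_lt continuous_const Complex.continuous_re).mem_nhds (by simp; linarith)
  · exact Eventually.of_forall fun w => Measurable.aestronglyMeasurable (by fun_prop)
  · exact integrableOn_cpow_mul_exp_neg_mul ha hr
  · exact Measurable.aestronglyMeasurable (by fun_prop)
  · filter_upwards [ae_restrict_mem measurableSet_Ioi] with t ht w hw
    have ht : 0 < t := ht
    have hw : r.re / 2 < w.re := hw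
    rw [norm_mul, norm_mul, Complex.norm_cpow_eq_rpow_re_of_pos ht, Complex.norm_exp, norm_neg,
      Complex.norm_real, Real.norm_of_nonneg ht.le]
    have h1 : t ^ a.re = t ^ (a - 1).re * t := by
      rw [← Real.rpow_add_one ht.ne']; simp
    have h2 : Real.exp (-(w * t)).re ≤ Real.exp (-(r.re / 2) * t ^ (1 : ℝ)) := by
      simp only [Complex.neg_re, Complex.re_mul_ofReal, Real.rpow_one]
      gcongr
      nlinarith
    rw [h1, mul_comm (Real.exp _) t, ← mul_assoc]
    gcongr
  · exact integrableOn_rpow_mul_exp_neg_mul_rpow (by linarith) one_pos (by positivity)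
  · refine Eventually.of_forall fun t w _ => ?_
    have h1 : HasDerivAt (fun w : ℂ => -(w * t)) (-t) w :=
      (hasDerivAt_mul_const (t : ℂ)).fun_neg
    exact h1.cexp.const_mul _

/-- Euler's integral for `Γ`, scaled by a complex number with positive real part. -/
theorem Complex.integral_cpow_mul_exp_neg_mul_Ioi_of_re_pos {a r : ℂ} (ha : 0 < a.re)
    (hr : 0 < r.re) :
    ∫ t in Set.Ioi (0 : ℝ), (t : ℂ) ^ (a - 1) * Complex.exp (-(r * t)) =
      (1 / r) ^ a * Complex.Gamma a := by
  have hopen : IsOpen {w : ℂ | 0 < w.re} := isOpen_lt continuous_const Complex.continuous_re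
  have h1 : AnalyticOnNhd ℂ (fun r : ℂ => ∫ t in Set.Ioi (0 : ℝ),
      (t : ℂ) ^ (a - 1) * Complex.exp (-(r * t))) {w : ℂ | 0 < w.re} :=
    DifferentiableOn.analyticOnNhd (fun w hw => (hasDerivAt_integral_cpow_mul_exp_neg_mul ha
      hw).differentiableAt.differentiableWithinAt) hopen
  have h2 : AnalyticOnNhd ℂ (fun r : ℂ => (1 / r) ^ a * Complex.Gamma a) {w : ℂ | 0 < w.re} := by
    refine DifferentiableOn.analyticOnNhd (fun w hw => ?_) hopen
    have hw : 0 < w.re := hw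
    have hw0 : w ≠ 0 := by rintro rfl; simp at hw
    have h3 : 1 / w ∈ Complex.slitPlane := by
      refine Or.inl ?_
      rw [one_div, Complex.inv_re]
      exact div_pos hw (Complex.normSq_pos.2 hw0)
    have h4 : DifferentiableAt ℂ (fun r : ℂ => 1 / r) w :=
      (differentiableAt_const _).div differentiableAt_id hw0
    exact ((h4.cpow_const h3).mul_const _).differentiableWithinAt
  refine h1.eqOn_of_preconnected_of_frequently_eq h2
    (convex_halfSpace_re_gt 0).isPreconnected (z₀ := 1) (by simp) ?_ hr
  -- The formula is known for real scales; these accumulate at `1`, so the identity theorem extends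
  -- it to the half-plane.
  have h5 : Tendsto (fun x : ℝ => (x : ℂ)) (𝓝[>] 1) (𝓝[≠] 1) := by
    refine tendsto_nhdsWithin_iff.2 ⟨?_, ?_⟩
    · exact (Complex.continuous_ofReal.tendsto' 1 1 (by simp)).mono_left nhdsWithin_le_nhds
    · filter_upwards [self_mem_nhdsWithin] with x hx
      have hx : 1 < x := hx
      simpa using hx.ne'
  refine h5.frequently (Eventually.frequently ?_)
  filter_upwards [self_mem_nhdsWithin] with x hx
  exact Complex.integral_cpow_mul_exp_neg_mul_Ioi ha (one_pos.trans hx)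

/-! ### Hausdorff operators on `(0, 1)` as functions of the Cesàro operator -/

/-- The function `F` with `hausdorffOp K = F(cesaroOp)`, for `K` supported in `(0, 1)`. -/
noncomputable def cesaroSymbol (K : ℝ → ℂ) (z : ℂ) : ℂ :=
  if z = 0 then 0 else ∫ u in Set.Ioo (0 : ℝ) 1, K u * (u : ℂ) ^ (z⁻¹ - 1)

theorem norm_ofReal_cpow_sub_one {u : ℝ} (hu : 0 < u) {s : ℂ} (hs : s.re = 1 / 2) :
    ‖(u : ℂ) ^ (s - 1)‖ = |u| ^ (-(1 / 2) : ℝ) := by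
  rw [Complex.norm_cpow_eq_rpow_re_of_pos hu, abs_of_pos hu, Complex.sub_re, hs]
  norm_num

theorem HausdorffKernel.integrableOn_mul_cpow {K : ℝ → ℂ} (hK : HausdorffKernel K) {s : ℂ}
    (hs : s.re = 1 / 2) :
    IntegrableOn (fun u : ℝ => K u * (u : ℂ) ^ (s - 1)) (Set.Ioo 0 1) := by
  refine Integrable.mono (Integrable.integrableOn hK) ?_ ?_
  · exact (hK.aestronglyMeasurable.mul (Measurable.aestronglyMeasurable (by fun_prop))).restrict
  · filter_upwards [ae_restrict_mem measurableSet_Ioo] with u hu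
    rw [norm_mul, norm_mul, norm_ofReal_cpow_sub_one hu.1 hs, Complex.norm_real,
      Real.norm_of_nonneg (by positivity : (0 : ℝ) ≤ |u| ^ (-(1 / 2) : ℝ))]

/-- The bound is the one that `norm_hausdorffOp_le` gives for the operator, so a single
approximation of the kernel controls both sides of the identity. -/
theorem norm_cesaroSymbol_le {K : ℝ → ℂ} (hK : HausdorffKernel K) {z : ℂ}
    (hz : z ∈ spectrum ℂ cesaroOp) :
    ‖cesaroSymbol K z‖ ≤ ∫ u, ‖K u‖ * |u| ^ (-(1 / 2) : ℝ) := by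
  have h0 : ∀ u : ℝ, 0 ≤ ‖K u‖ * |u| ^ (-(1 / 2) : ℝ) := fun u => by positivity
  have hn : Integrable fun u : ℝ => ‖K u‖ * |u| ^ (-(1 / 2) : ℝ) := by
    refine (Integrable.norm hK).congr (Eventually.of_forall fun u => ?_)
    simp only [norm_mul, Complex.norm_real]
    rw [Real.norm_of_nonneg (by positivity : (0 : ℝ) ≤ |u| ^ (-(1 / 2) : ℝ))]
  rw [cesaroSymbol]
  split_ifs with hz0
  · rw [norm_zero]
    exact integral_nonneg h0
  refine (norm_integral_le_integral_norm _).trans ?_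
  refine le_trans (le_of_eq ?_) (setIntegral_le_integral (s := Set.Ioo (0 : ℝ) 1) hn
    (Eventually.of_forall h0))
  refine setIntegral_congr_fun measurableSet_Ioo fun u hu => ?_
  simp only [norm_mul]
  rw [norm_ofReal_cpow_sub_one hu.1 (re_inv_of_mem_spectrum_cesaroOp hz hz0)]

theorem cesaroSymbol_add {K L : ℝ → ℂ} (hK : HausdorffKernel K) (hL : HausdorffKernel L) {z : ℂ}
    (hz : z ∈ spectrum ℂ cesaroOp) :
    cesaroSymbol (fun u => K u + L u) z = cesaroSymbol K z + cesaroSymbol L z := by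
  simp only [cesaroSymbol]
  split_ifs with hz0
  · rw [add_zero]
  have hs := re_inv_of_mem_spectrum_cesaroOp hz hz0
  rw [← integral_add (hK.integrableOn_mul_cpow hs) (hL.integrableOn_mul_cpow hs)]
  simp only [add_mul]

theorem cesaroSymbol_const_mul (K : ℝ → ℂ) (c z : ℂ) :
    cesaroSymbol (fun u => c * K u) z = c * cesaroSymbol K z := by
  simp only [cesaroSymbol]
  split_ifs with hz0
  · rw [mul_zero]
  rw [← integral_const_mul]
  simp only [mul_assoc]

theorem cesaroSymbol_sub {K L : ℝ → ℂ} (hK : HausdorffKernel K) (hL : HausdorffKernel L) {z : ℂ}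
    (hz : z ∈ spectrum ℂ cesaroOp) :
    cesaroSymbol (fun u => K u - L u) z = cesaroSymbol K z - cesaroSymbol L z := by
  rw [eq_sub_iff_add_eq, ← cesaroSymbol_add (hK.sub hL) hL hz]
  simp

theorem cesaroSymbol_pow (n : ℕ) {z : ℂ} (hz : z ∈ spectrum ℂ cesaroOp) :
    cesaroSymbol ((Set.Ioo (0 : ℝ) 1).indicator fun u : ℝ => (u : ℂ) ^ n) z =
      z * (1 + n * z)⁻¹ := by
  rw [cesaroSymbol]
  split_ifs with hz0
  · rw [hz0, zero_mul]
  have hs := re_inv_of_mem_spectrum_cesaroOp hz hz0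
  have e : ∫ u in Set.Ioo (0 : ℝ) 1,
      (Set.Ioo (0 : ℝ) 1).indicator (fun u : ℝ => (u : ℂ) ^ n) u * (u : ℂ) ^ (z⁻¹ - 1) =
      ∫ u in (0 : ℝ)..1, (u : ℂ) ^ ((n : ℂ) + z⁻¹ - 1) := by
    rw [intervalIntegral.integral_of_le zero_le_one, integral_Ioc_eq_integral_Ioo]
    refine setIntegral_congr_fun measurableSet_Ioo fun u hu => ?_
    have hu0 : (u : ℂ) ≠ 0 := Complex.ofReal_ne_zero.2 hu.1.ne'
    simp only [Set.indicator_of_mem hu]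
    rw [add_sub_assoc, Complex.cpow_add _ _ hu0, Complex.cpow_natCast]
  have hre : (0 : ℝ) < ((n : ℂ) + z⁻¹).re := by
    rw [Complex.add_re, hs, Complex.natCast_re]; positivity
  have hne : (n : ℂ) + z⁻¹ ≠ 0 := fun h => by rw [h] at hre; simp at hre
  rw [e, integral_cpow (Or.inl (by rw [Complex.sub_re, Complex.one_re]; linarith)), sub_add_cancel,
    Complex.ofReal_one, Complex.one_cpow, Complex.ofReal_zero, Complex.zero_cpow hne, sub_zero]
  have h1 : 1 + n * z = z * (n + z⁻¹) := by field_simp; ring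
  rw [h1]
  field_simp

/-- `hausdorffOp K` is the function `cesaroSymbol K` of the Cesàro operator. -/
structure IsCesaroFunction (K : ℝ → ℂ) : Prop where
  kernel : HausdorffKernel K
  continuousOn : ContinuousOn (cesaroSymbol K) (spectrum ℂ cesaroOp)
  eq_cfc : hausdorffOp K kernel = cfc (cesaroSymbol K) cesaroOp

theorem IsCesaroFunction.add {K L : ℝ → ℂ} (hK : IsCesaroFunction K) (hL : IsCesaroFunction L) :
    IsCesaroFunction fun u => K u + L u where
  kernel := hK.kernel.add hL.kernel
  continuousOn := (hK.continuousOn.add hL.continuousOn).congr fun _ hz =>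
    cesaroSymbol_add hK.kernel hL.kernel hz
  eq_cfc := by
    rw [hausdorffOp_add hK.kernel hL.kernel, hK.eq_cfc, hL.eq_cfc,
      ← cfc_add _ _ _ hK.continuousOn hL.continuousOn]
    exact cfc_congr fun _ hz => (cesaroSymbol_add hK.kernel hL.kernel hz).symm

theorem IsCesaroFunction.const_mul {K : ℝ → ℂ} (hK : IsCesaroFunction K) (c : ℂ) :
    IsCesaroFunction fun u => c * K u where
  kernel := hK.kernel.const_mul c
  continuousOn := (continuousOn_const.mul hK.continuousOn).congr fun z _ =>
    cesaroSymbol_const_mul K c z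
  eq_cfc := by
    rw [hausdorffOp_const_mul hK.kernel, hK.eq_cfc, ← cfc_const_mul _ _ _ hK.continuousOn]
    exact cfc_congr fun z _ => (cesaroSymbol_const_mul K c z).symm

theorem one_add_natCast_mul_ne_zero (n : ℕ) {z : ℂ} (hz : 0 ≤ z.re) : 1 + n * z ≠ 0 := fun h => by
  have h1 := congrArg Complex.re h
  simp only [Complex.add_re, Complex.one_re, Complex.zero_re, Complex.mul_re,
    Complex.natCast_re, Complex.natCast_im, zero_mul, sub_zero] at h1
  have : 0 ≤ n * z.re := by positivity
  linarith

/-- The symbol is `∫_0^1 u^(n + 1/z - 1) du = z / (1 + n z)`, whose denominator does not vanish on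
the right half-plane. For `n = 0` the operator is `C` itself; otherwise `H (1 + n C) = C` is solved
for `H`. -/
theorem isCesaroFunction_pow (n : ℕ) :
    IsCesaroFunction ((Set.Ioo (0 : ℝ) 1).indicator fun u : ℝ => (u : ℂ) ^ n) := by
  have hN := isStarNormal_cesaroOp
  have hne : ∀ m : ℕ, ∀ z ∈ spectrum ℂ cesaroOp, 1 + (m : ℂ) * z ≠ 0 := fun m z hz =>
    one_add_natCast_mul_ne_zero m (re_nonneg_of_mem_spectrum_cesaroOp hz)
  have hc1 : ∀ m : ℕ, ContinuousOn (fun z : ℂ => 1 + (m : ℂ) * z) (spectrum ℂ cesaroOp) :=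
    fun m => by fun_prop
  have hc2 : ∀ m : ℕ, ContinuousOn (fun z : ℂ => (1 + (m : ℂ) * z)⁻¹) (spectrum ℂ cesaroOp) :=
    fun m => (hc1 m).inv₀ (hne m)
  refine ⟨hausdorffKernel_indicator_of_continuous (by fun_prop),
    (continuousOn_id.mul (hc2 n)).congr fun z hz => cesaroSymbol_pow n hz, ?_⟩
  rw [cfc_congr fun z hz => cesaroSymbol_pow n hz]
  rcases n with _ | n
  · simp only [Nat.cast_zero, zero_mul, add_zero, inv_one, mul_one]
    rw [cfc_id' ℂ cesaroOp]
    exact hausdorffOp_congr _ _ (Eventually.of_forall fun u => by simp [cesaroKernel])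
  set H := hausdorffOp _ (hausdorffKernel_indicator_of_continuous
      (p := fun u : ℝ => (u : ℂ) ^ (n + 1)) (by fun_prop)) with hH
  have h1 : H * cesaroOp = ((n + 1 : ℂ)⁻¹) • (cesaroOp - H) := hausdorffOp_pow_mul_cesaroOp n
  have hn : (n + 1 : ℂ) ≠ 0 := Nat.cast_add_one_ne_zero n
  have h2 : cfc (fun z : ℂ => 1 + ((n + 1 : ℕ) : ℂ) * z) cesaroOp = 1 + (n + 1 : ℂ) • cesaroOp := by
    rw [cfc_add cesaroOp (fun _ : ℂ => (1 : ℂ)) (fun z => ((n + 1 : ℕ) : ℂ) * z)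
      continuousOn_const (by fun_prop), cfc_const_one ℂ cesaroOp, cfc_const_mul_id _ cesaroOp]
    push_cast
    rfl
  have h3 : H * cfc (fun z : ℂ => 1 + ((n + 1 : ℕ) : ℂ) * z) cesaroOp = cesaroOp := by
    rw [h2, mul_add, mul_one, mul_smul_comm, h1, smul_smul, mul_inv_cancel₀ hn, one_smul]
    abel
  have h4 : cfc (fun z : ℂ => 1 + ((n + 1 : ℕ) : ℂ) * z) cesaroOp *
      cfc (fun z : ℂ => (1 + ((n + 1 : ℕ) : ℂ) * z)⁻¹) cesaroOp = 1 := by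
    rw [← cfc_mul _ _ _ (hc1 _) (hc2 _), ← cfc_const_one ℂ cesaroOp]
    exact cfc_congr fun z hz => mul_inv_cancel₀ (hne _ z hz)
  rw [cfc_mul (fun z : ℂ => z) _ _ continuousOn_id (hc2 _), cfc_id' ℂ cesaroOp]
  calc H = H * (cfc (fun z : ℂ => 1 + ((n + 1 : ℕ) : ℂ) * z) cesaroOp *
      cfc (fun z : ℂ => (1 + ((n + 1 : ℕ) : ℂ) * z)⁻¹) cesaroOp) := by rw [h4, mul_one]
    _ = _ := by rw [← mul_assoc, h3]

theorem isCesaroFunction_polynomial (p : Polynomial ℂ) :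
    IsCesaroFunction ((Set.Ioo (0 : ℝ) 1).indicator fun u : ℝ => p.eval (u : ℂ)) := by
  induction p using Polynomial.induction_on' with
  | add p q hp hq =>
    refine Eq.mp (congrArg IsCesaroFunction ?_) (hp.add hq)
    ext u
    by_cases hu : u ∈ Set.Ioo (0 : ℝ) 1 <;> simp [hu]
  | monomial n c =>
    refine Eq.mp (congrArg IsCesaroFunction ?_) ((isCesaroFunction_pow n).const_mul c)
    ext u
    by_cases hu : u ∈ Set.Ioo (0 : ℝ) 1 <;> simp [hu]

/-- Weighted `L¹` approximation of kernels gives uniform approximation of symbols on the spectrum,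
hence continuity, and norm approximation of both operators. -/
theorem isCesaroFunction_of_approx {K : ℝ → ℂ} (hK : HausdorffKernel K)
    (h : ∀ ε > 0, ∃ L, IsCesaroFunction L ∧ ∫ u, ‖K u - L u‖ * |u| ^ (-(1 / 2) : ℝ) ≤ ε) :
    IsCesaroFunction K := by
  have hN := isStarNormal_cesaroOp
  have hsym : ∀ ε > 0, ∀ L, IsCesaroFunction L → ∫ u, ‖K u - L u‖ * |u| ^ (-(1 / 2) : ℝ) ≤ ε →
      ∀ z ∈ spectrum ℂ cesaroOp, ‖cesaroSymbol K z - cesaroSymbol L z‖ ≤ ε :=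
    fun ε _ L hL hKL z hz => by
      rw [← cesaroSymbol_sub hK hL.kernel hz]
      exact (norm_cesaroSymbol_le (hK.sub hL.kernel) hz).trans hKL
  have hc : ContinuousOn (cesaroSymbol K) (spectrum ℂ cesaroOp) := by
    refine continuousOn_of_uniform_approx_of_continuousOn fun u hu => ?_
    obtain ⟨ε, hε, hu⟩ := Metric.mem_uniformity_dist.1 hu
    obtain ⟨L, hL, hKL⟩ := h (ε / 2) (by positivity)
    refine ⟨_, hL.continuousOn, fun z hz => hu ?_⟩
    rw [dist_eq_norm]
    exact (hsym _ (by positivity) L hL hKL z hz).trans_lt (by linarith)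
  refine ⟨hK, hc, ?_⟩
  refine eq_of_forall_dist_le fun ε hε => ?_
  obtain ⟨L, hL, hKL⟩ := h (ε / 2) (by positivity)
  have h1 : ‖hausdorffOp K hK - hausdorffOp L hL.kernel‖ ≤ ε / 2 := by
    rw [← hausdorffOp_sub]
    exact (norm_hausdorffOp_le _).trans hKL
  have h2 : ‖cfc (cesaroSymbol K) cesaroOp - cfc (cesaroSymbol L) cesaroOp‖ ≤ ε / 2 := by
    rw [← cfc_sub _ _ _ hc hL.continuousOn]
    exact norm_cfc_le (by positivity) (hsym _ (by positivity) L hL hKL)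
  rw [dist_eq_norm]
  have h3 : hausdorffOp K hK - cfc (cesaroSymbol K) cesaroOp =
      (hausdorffOp K hK - hausdorffOp L hL.kernel) -
        (cfc (cesaroSymbol K) cesaroOp - cfc (cesaroSymbol L) cesaroOp) := by
    rw [hL.eq_cfc]; abel
  rw [h3]
  exact (norm_sub_le _ _).trans (by linarith)

theorem exists_polynomial_near_of_continuous {g : ℝ → ℂ} (hg : Continuous g) {ε : ℝ}
    (hε : 0 < ε) : ∃ p : Polynomial ℂ, ∀ u ∈ Set.Icc (0 : ℝ) 1, ‖g u - p.eval (u : ℂ)‖ ≤ ε := by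
  obtain ⟨p, hp⟩ := exists_polynomial_near_of_continuousOn 0 1 (fun u => (g u).re)
    (Complex.continuous_re.comp hg).continuousOn (ε / 2) (by positivity)
  obtain ⟨q, hq⟩ := exists_polynomial_near_of_continuousOn 0 1 (fun u => (g u).im)
    (Complex.continuous_im.comp hg).continuousOn (ε / 2) (by positivity)
  refine ⟨p.map Complex.ofRealHom + Polynomial.C Complex.I * q.map Complex.ofRealHom,
    fun u hu => ?_⟩
  have hev : ∀ r : Polynomial ℝ, (r.map Complex.ofRealHom).eval (u : ℂ) = ((r.eval u : ℝ) : ℂ) :=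
    fun r => by
      rw [Polynomial.eval_map, ← Complex.ofRealHom_eq_coe, Polynomial.eval₂_at_apply]
      rfl
  rw [Polynomial.eval_add, Polynomial.eval_mul, Polynomial.eval_C, hev, hev]
  refine (Complex.norm_le_abs_re_add_abs_im _).trans ?_
  have h1 := hp u hu
  have h2 := hq u hu
  rw [abs_sub_comm] at h1 h2
  simp
  linarith

/-- Polynomials are dense in the weighted `L¹` space on `(0, 1)`: approximate `K |u|^(-1/2)` in `L¹`
by a continuous `g`, then `g |u|^(1/2)` uniformly by a polynomial. -/
theorem isCesaroFunction_of_support {K : ℝ → ℂ} (hK : HausdorffKernel K)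
    (hsupp : ∀ u, u ∉ Set.Ioo (0 : ℝ) 1 → K u = 0) : IsCesaroFunction K := by
  refine isCesaroFunction_of_approx hK fun ε hε => ?_
  obtain ⟨g, -, hg1, hg, hgi⟩ :=
    Integrable.exists_hasCompactSupport_integral_sub_le hK (by positivity : 0 < ε / 2)
  have hI : Integrable fun u : ℝ => ‖cesaroKernel u‖ * |u| ^ (-(1 / 2) : ℝ) := by
    refine (Integrable.norm hausdorffKernel_cesaroKernel).congr (Eventually.of_forall fun u => ?_)
    simp only [norm_mul, Complex.norm_real]
    rw [Real.norm_of_nonneg (by positivity : (0 : ℝ) ≤ |u| ^ (-(1 / 2) : ℝ))]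
  set c := ∫ u, ‖cesaroKernel u‖ * |u| ^ (-(1 / 2) : ℝ) with hc
  have hc0 : 0 ≤ c := integral_nonneg fun u => by positivity
  -- A uniform error on `[0, 1]` costs a factor `c = ∫_0^1 u^(-1/2) du`, hence the tolerance; the `+
  -- 1` keeps the denominator positive without evaluating `c`.
  obtain ⟨p, hp⟩ := exists_polynomial_near_of_continuous
    (g := fun u => g u * ((|u| ^ (1 / 2 : ℝ) : ℝ) : ℂ))
    (hg.mul (Complex.continuous_ofReal.comp (continuous_abs.rpow_const fun _ =>
      Or.inr (by norm_num)))) (by positivity : 0 < ε / (2 * (c + 1)))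
  refine ⟨_, isCesaroFunction_polynomial p, ?_⟩
  have hb : ∀ u : ℝ, ‖K u - (Set.Ioo (0 : ℝ) 1).indicator (fun u : ℝ => p.eval (u : ℂ)) u‖ *
      |u| ^ (-(1 / 2) : ℝ) ≤ ‖K u * ((|u| ^ (-(1 / 2) : ℝ) : ℝ) : ℂ) - g u‖ +
        ε / (2 * (c + 1)) * (‖cesaroKernel u‖ * |u| ^ (-(1 / 2) : ℝ)) := fun u => by
    have h0 : (0 : ℝ) ≤ |u| ^ (-(1 / 2) : ℝ) := by positivity
    by_cases hu : u ∈ Set.Ioo (0 : ℝ) 1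
    · have h1 := hp u ⟨hu.1.le, hu.2.le⟩
      have h2 : |u| ^ (1 / 2 : ℝ) * |u| ^ (-(1 / 2) : ℝ) = 1 := by
        rw [← Real.rpow_add (abs_pos.2 hu.1.ne')]; norm_num
      have h2' : ((|u| ^ (1 / 2 : ℝ) : ℝ) : ℂ) * ((|u| ^ (-(1 / 2) : ℝ) : ℝ) : ℂ) = 1 := by
        rw [← Complex.ofReal_mul, h2, Complex.ofReal_one]
      rw [cesaroKernel, Set.indicator_of_mem hu, Set.indicator_of_mem hu, norm_one, one_mul]
      have h3 : ‖K u - p.eval (u : ℂ)‖ * |u| ^ (-(1 / 2) : ℝ) =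
          ‖(K u - p.eval (u : ℂ)) * ((|u| ^ (-(1 / 2) : ℝ) : ℝ) : ℂ)‖ := by
        rw [norm_mul, Complex.norm_real, Real.norm_of_nonneg h0]
      have h4 : (K u - p.eval (u : ℂ)) * ((|u| ^ (-(1 / 2) : ℝ) : ℝ) : ℂ) =
          (K u * ((|u| ^ (-(1 / 2) : ℝ) : ℝ) : ℂ) - g u) +
          (g u * ((|u| ^ (1 / 2 : ℝ) : ℝ) : ℂ) - p.eval (u : ℂ)) *
            ((|u| ^ (-(1 / 2) : ℝ) : ℝ) : ℂ) := by
        linear_combination (-g u) * h2'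
      rw [h3, h4]
      refine (norm_add_le _ _).trans ?_
      rw [norm_mul (_ - Polynomial.eval _ _), Complex.norm_real, Real.norm_of_nonneg h0]
      gcongr
    · rw [cesaroKernel, Set.indicator_of_notMem hu, Set.indicator_of_notMem hu, hsupp u hu]
      simp
  have hI1 : Integrable fun u : ℝ => ‖K u * ((|u| ^ (-(1 / 2) : ℝ) : ℝ) : ℂ) - g u‖ :=
    (Integrable.sub hK hgi).norm
  calc _ ≤ ∫ u, (‖K u * ((|u| ^ (-(1 / 2) : ℝ) : ℝ) : ℂ) - g u‖ +
        ε / (2 * (c + 1)) * (‖cesaroKernel u‖ * |u| ^ (-(1 / 2) : ℝ))) :=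
        integral_mono_of_nonneg (Eventually.of_forall fun u => by positivity)
          (hI1.add (hI.const_mul _)) (Eventually.of_forall hb)
    _ ≤ ε / 2 + ε / (2 * (c + 1)) * c := by
        rw [integral_add hI1 (hI.const_mul _), integral_const_mul]
        gcongr
    _ ≤ ε := by
        have : ε / (2 * (c + 1)) * c ≤ ε / 2 := by
          rw [div_mul_eq_mul_div, div_le_div_iff₀ (by positivity) (by norm_num)]
          nlinarith
        linarith

/-- The substitution `u = e^(-t)` turns the symbol into `Γ(α)⁻¹ ∫ t^(α-1) e^(-t/z) dt`, Euler's
integral with scale `1/z`, which has real part `1/2`. -/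
theorem cesaroSymbol_holderKernel {α : ℂ} (hα : 0 < α.re) {z : ℂ}
    (hz : z ∈ spectrum ℂ cesaroOp) : cesaroSymbol (holderKernel α) z = z ^ α := by
  have hα0 : α ≠ 0 := by rintro rfl; simp at hα
  rw [cesaroSymbol]
  split_ifs with hz0
  · rw [hz0, Complex.zero_cpow hα0]
  have hs := re_inv_of_mem_spectrum_cesaroOp hz hz0
  have himg : (fun t : ℝ => Real.exp (-t)) '' (Set.Ioi 0) = Set.Ioo 0 1 := by
    ext u
    constructor
    · rintro ⟨t, ht, rfl⟩
      exact ⟨Real.exp_pos _, by simpa using ht⟩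
    · rintro ⟨h0, h1⟩
      exact ⟨-Real.log u, by simpa using Real.log_neg h0 h1, by simp [Real.exp_log h0]⟩
  have e : ∫ u in Set.Ioo (0 : ℝ) 1, holderKernel α u * (u : ℂ) ^ (z⁻¹ - 1) =
      (Complex.Gamma α)⁻¹ *
        ∫ t in Set.Ioi (0 : ℝ), (t : ℂ) ^ (α - 1) * Complex.exp (-(z⁻¹ * t)) := by
    rw [← integral_const_mul]
    conv_lhs => rw [← himg]
    rw [integral_image_eq_integral_abs_deriv_smul (f := fun t => Real.exp (-t))
      (f' := fun t => -Real.exp (-t)) measurableSet_Ioi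
      (fun t _ => by simpa using ((hasDerivAt_neg t).exp).hasDerivWithinAt)
      (fun a _ b _ h => by simpa using h)]
    refine setIntegral_congr_fun measurableSet_Ioi fun t ht => ?_
    have hmem : Real.exp (-t) ∈ Set.Ioo (0 : ℝ) 1 := himg ▸ Set.mem_image_of_mem _ ht
    simp only [holderKernel, Set.indicator_of_mem hmem]
    have h1 : ((Real.exp (-t) : ℝ) : ℂ) ≠ 0 := Complex.ofReal_ne_zero.2 (Real.exp_pos _).ne'
    have h2 : |-Real.exp (-t)| • (((Real.exp (-t) : ℝ) : ℂ) ^ (z⁻¹ - 1)) =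
        Complex.exp (-(z⁻¹ * t)) := by
      rw [abs_neg, abs_of_pos (Real.exp_pos _), Complex.real_smul, Complex.cpow_sub _ _ h1,
        Complex.cpow_one, mul_div_cancel₀ _ h1, Complex.cpow_def_of_ne_zero h1,
        ← Complex.ofReal_log (Real.exp_pos _).le, Real.log_exp]
      congr 1
      push_cast
      ring
    rw [one_div, one_div, Real.log_inv, Real.log_exp, neg_neg, mul_assoc, ← mul_smul_comm,
      ← mul_smul_comm, h2]
  rw [e, Complex.integral_cpow_mul_exp_neg_mul_Ioi_of_re_pos hα (by rw [hs]; norm_num), one_div,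
    inv_inv, mul_comm, mul_assoc, mul_inv_cancel₀ (Complex.Gamma_ne_zero_of_re_pos hα), mul_one]

theorem holderOp_eq_cfc {α : ℂ} (hα : 0 < α.re) :
    holderOp α = cfc (fun z : ℂ => z ^ α) cesaroOp := by
  rw [holderOp, dif_pos hα, (isCesaroFunction_of_support (hausdorffKernel_holderKernel hα)
    fun u hu => Set.indicator_of_notMem hu _).eq_cfc]
  exact cfc_congr fun z hz => cesaroSymbol_holderKernel hα hz

/-! ### Positivity and conclusion -/

theorem isPositivityPreserving_hausdorffOp {k : ℝ → ℝ} (hk : ∀ u, 0 ≤ k u)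
    (hK : HausdorffKernel fun u => (k u : ℂ)) :
    IsPositivityPreserving (hausdorffOp (fun u => (k u : ℂ)) hK) := by
  intro f hf
  filter_upwards [hausdorffOp_apply_ae _ hK f, ae_ne_zero_real] with x hx hx0
  have h1 : ∫ u, (k u : ℂ) * f (u * x) = ((∫ u, k u * (f (u * x)).re : ℝ) : ℂ) := by
    rw [← integral_complex_ofReal]
    refine integral_congr_ae ?_
    filter_upwards [(quasiMeasurePreserving_mul_right_of_ne_zero hx0).ae hf] with u hu
    rw [Complex.ofReal_mul]
    congr 1
    exact Complex.ext rfl (by rw [hu.2, Complex.ofReal_im])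
  rw [hx, h1, Complex.ofReal_re, Complex.ofReal_im]
  refine ⟨integral_nonneg_of_ae ?_, rfl⟩
  filter_upwards [(quasiMeasurePreserving_mul_right_of_ne_zero hx0).ae hf] with u hu
  exact mul_nonneg (hk u) hu.1

theorem isPositivityPreserving_holderOp {t : ℝ} (ht : 0 ≤ t) :
    IsPositivityPreserving (holderOp (t : ℂ)) := by
  rcases ht.eq_or_lt with rfl | ht
  · rw [holderOp, dif_neg (by simp)]
    exact fun f hf => hf
  have ht' : 0 < (t : ℂ).re := by simpa using ht
  have hlog : ∀ u ∈ Set.Ioo (0 : ℝ) 1, 0 ≤ Real.log (1 / u) := fun u hu =>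
    Real.log_nonneg ((one_le_div hu.1).2 hu.2.le)
  -- For real `t` the complex power and the complex Gamma function are real, because `log (1 / u) ≥
  -- 0` on `(0, 1)`.
  have hker : holderKernel (t : ℂ) = fun u => (((Set.Ioo (0 : ℝ) 1).indicator
      (fun u => 1 / Real.Gamma t * Real.log (1 / u) ^ (t - 1)) u : ℝ) : ℂ) := by
    ext u
    by_cases hu : u ∈ Set.Ioo (0 : ℝ) 1
    · rw [holderKernel, Set.indicator_of_mem hu, Set.indicator_of_mem hu, Complex.Gamma_ofReal,
        Complex.ofReal_mul, Complex.ofReal_cpow (hlog u hu)]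
      push_cast
      rfl
    · rw [holderKernel, Set.indicator_of_notMem hu, Set.indicator_of_notMem hu, Complex.ofReal_zero]
  have hK := hausdorffKernel_holderKernel ht'
  rw [hker] at hK
  have h1 : holderOp (t : ℂ) = hausdorffOp _ hK := by
    rw [holderOp, dif_pos ht']
    exact hausdorffOp_congr _ _ (Eventually.of_forall fun u => congrFun hker u)
  rw [h1]
  refine isPositivityPreserving_hausdorffOp (fun u => Set.indicator_nonneg (fun u hu => ?_) u) hK
  have := Real.Gamma_pos_of_pos ht
  have := Real.rpow_nonneg (hlog u hu) (t - 1)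
  positivity

theorem isPowerFamily_holderOp : IsPowerFamily cesaroOp holderOp where
  normal := isStarNormal_cesaroOp
  re_nonneg _ hz := re_nonneg_of_mem_spectrum_cesaroOp hz
  denseRange := denseRange_cesaroOp
  map_zero := dif_neg (by simp)
  eq_cfc _ hα := holderOp_eq_cfc hα

theorem mainTheorem10 :
    -- `H_α` is the power `C^α` of the normal operator `C` (functional calculus)
    IsStarNormal cesaroOp ∧
    (∀ α : ℂ, 0 < α.re → holderOp α = cfc (fun z : ℂ => z ^ α) cesaroOp) ∧
    -- the family `H_α` is a semigroup, holomorphic in the right half-plane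
    IsHolomorphicSemigroup holderOp ∧
    -- its generator is normal, with spectrum in a half-plane `Re z ≤ γ`
    IsNormalOperator (generator fun t : ℝ => holderOp (t : ℂ)) ∧
    (∃ γ : ℝ, ∀ z ∈ operatorSpectrum (generator fun t : ℝ => holderOp (t : ℂ)), z.re ≤ γ) ∧
    -- its restriction to `α ≥ 0` is a positive semigroup
    (IsC0Semigroup (fun t : ℝ => holderOp (t : ℂ)) ∧
      ∀ t : ℝ, 0 ≤ t → IsPositivityPreserving (holderOp (t : ℂ))) := by
  exact ⟨isStarNormal_cesaroOp, fun _ hα => holderOp_eq_cfc hα,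
    isPowerFamily_holderOp.isHolomorphicSemigroup, isPowerFamily_holderOp.isNormalOperator_generator,
    isPowerFamily_holderOp.re_le_of_mem_operatorSpectrum, isPowerFamily_holderOp.isC0Semigroup,
    fun _ ht => isPositivityPreserving_holderOp ht⟩
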